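/- **Setting.** Let $K\ge 2$ and, for $i=1,\dots,K$, let $\mu_i\in\mathbb{R}$, $\sigma_i>0$; the rewards $x_{i,1},x_{i,2},\dots$ of arm $i$ are uniform on $[\mu_i-\sigma_i/2,\ \mu_i+\sigma_i/2]$ (law $\nu_{\mu_i,\sigma_i}$), and all rewards are independent. Arm $1$ is the unique optimal arm: $\mu_1>\mu_i$ for $i\neq 1$. Put $\Delta_i=\mu_1-\mu_i$, $\Delta_{\max}=\max_{i\ne1}\Delta_i$. If $j(t)$ is the arm played in round $t$ and $N_i(t)$ the number of plays of arm $i$ before round $t$, then $\mathrm{Reg}(T)=\sum_{t=1}^T\Delta_{j(t)}$. Thompson sampling with prior $\sigma^{-k}$ is the following policy. In the first $Kn_0$ rounds, $n_0=\max(2,3-\lceil k\rceil)$, each arm is played $n_0$ times. In every later round $t$ it samples, independently for the arms $i$ given the past, a pair $(\tilde\mu_i(t),\tilde\sigma_i(t))$ from the posterior of arm $i$, which is the probability distribution on $\mathbb{R}\times(0,\infty)$ with density proportional to $$\sigma^{-k}\prod_{s=1}^{n}\frac1\sigma\mathbf 1\Big[\mu-\frac\sigma2\le x_{i,s}\le\mu+\frac\sigma2\Big],\qquad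 n=N_i(t),$$ and it plays an arm for which $\tilde\mu_i(t)$ is largest. **Theorem.** Let $k<1$ (the uniform prior, $k=0$, is included). (1) For every $\epsilon\in(0,\min_{i\ne1}\Delta_i/2)$ and every $T\ge1$, $$\mathbb{E}[\mathrm{Reg}(T)]\le\sum_{i=2}^K\Delta_i\left(\frac{\log T}{\log\big(1+\frac{2\Delta_i-4\epsilon}{\sigma_i}\big)}+\frac{2\sigma_i}{\epsilon}+\frac{11}{2}-\lceil k\rceil-k\right)+\Delta_{\max}\,C(\epsilon,k,\sigma_1),$$ where $$C(\epsilon,k,\sigma_1)=1+\frac{9\sigma_1}{\epsilon}+\frac{3}{16(1-k)}\frac{\sigma_1^2}{\epsilon^2}\big(2e^{2\epsilon/\sigma_1}-1\big).$$ (2) $C(\epsilon,k,\sigma_1)=\mathcal O\big(\frac{\sigma_1^2}{(1-k)\epsilon^2}\big)$, uniformly over all $k<1$, $\sigma_1>0$, $\epsilon>0$ with $k$ bounded below and $\epsilon/\sigma_1$ bounded above. (3) The policy is asymptotically optimal, that is $$\limsup_{T\to\infty}\frac{\mathbb{E}[\mathrm{Reg}(T)]}{\log T}\le\sum_{i=2}^K\frac{\Delta_i}{\inf_{m>\mu_1,\,s>0}\mathrm{KL}(\nu_{\mu_i,\sigma_i};\nu_{m,s})},\qquad\text{where}\quad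 \inf_{m>\mu_1,\,s>0}\mathrm{KL}(\nu_{\mu_i,\sigma_i};\nu_{m,s})=\log\Big(1+\frac{2\Delta_i}{\sigma_i}\Big)\quad(i\neq1).$$ -/

import Mathlib

open MeasureTheory ProbabilityTheory Filter
open scoped ENNReal

noncomputable section

namespace UniformBandit

/-- Density of the uniform distribution with location (mean) `m` and scale `s`, i.e. the uniform
density on `[m - s/2, m + s/2]`. -/
def uniPdf (m s x : ℝ) : ℝ :=
  if m - s / 2 ≤ x ∧ x ≤ m + s / 2 then 1 / s else 0

/-- The uniform distribution with location (mean) `m` and scale `s`. -/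
def uniLaw (m s : ℝ) : Measure ℝ :=
  volume.withDensity fun x => ENNReal.ofReal (uniPdf m s x)

/-- Prior density `s ^ (-k)` on the half plane of the parameters `(m, s)` with `0 < s`, times the
likelihood of the observations `x 0, …, x (n - 1)`. -/
def posteriorWeight (k : ℝ) (n : ℕ) (x : ℕ → ℝ) (p : ℝ × ℝ) : ℝ≥0∞ :=
  if 0 < p.2 then
    ENNReal.ofReal (p.2 ^ (-k) * ∏ r ∈ Finset.range n, uniPdf p.1 p.2 (x r))
  else 0

/-- The unnormalized posterior on the parameters `(m, s)`. -/
def unnormalizedPosterior (k : ℝ) (n : ℕ) (x : ℕ → ℝ) : Measure (ℝ × ℝ) :=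
  volume.withDensity (posteriorWeight k n x)

/-- The posterior distribution (Bayes' rule) of the parameters `(m, s)` under the prior
`s ^ (-k)`, given the observations `x 0, …, x (n - 1)`. -/
def posterior (k : ℝ) (n : ℕ) (x : ℕ → ℝ) : Measure (ℝ × ℝ) :=
  (unnormalizedPosterior k n x Set.univ)⁻¹ • unnormalizedPosterior k n x

/-- The number `max (2, 3 - ⌈k⌉)` of initial plays of each arm. -/
def initialPlays (k : ℝ) : ℕ := max 2 (3 - ⌈k⌉).toNat

/-- Rounds are numbered from `0`. `pulls j i t ω` is the number of the rounds before round `t` in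
which arm `i` is played, where `j s ω` is the arm played in round `s`. -/
def pulls {Ω : Type*} {K : ℕ} (j : ℕ → Ω → Fin K) (i : Fin K) (t : ℕ) (ω : Ω) : ℕ :=
  ((Finset.range t).filter fun s => j s ω = i).card

/-- The σ-algebra on which the sampling in round `t` is conditioned: it is generated by all rewards
`X i n` (the `n`-th reward of arm `i`, played or not) and by the parameters sampled and the arms
played in the rounds before `t`. -/
@[reducible] def past {Ω : Type*} {K : ℕ} (X : Fin K → ℕ → Ω → ℝ) (θ : ℕ → Fin K → Ω → ℝ × ℝ)
    (j : ℕ → Ω → Fin K) (t : ℕ) : MeasurableSpace Ω :=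
  (⨆ (i : Fin K) (n : ℕ), MeasurableSpace.comap (X i n) inferInstance) ⊔
    ⨆ (s : ℕ) (_ : s < t),
      (⨆ i : Fin K, MeasurableSpace.comap (θ s i) inferInstance) ⊔
        MeasurableSpace.comap (j s) inferInstance

/-- A run of Thompson sampling with prior `s ^ (-k)` on the `K`-armed uniform bandit whose arm `i`
has location `μ i` and scale `σ i`. Here `X i n` is the reward of the play number `n` (from `0`) of
arm `i` (so the reward received in round `t` is `X (j t) n` with `n` the number of earlier plays of
arm `j t`), `θ t i` is the pair (location, scale) sampled for arm `i` in round `t`, and `j t` is the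
arm played in round `t`. -/
structure IsThompsonSampling {Ω : Type*} [MeasurableSpace Ω] (P : Measure Ω) {K : ℕ}
    (μ σ : Fin K → ℝ) (k : ℝ) (X : Fin K → ℕ → Ω → ℝ) (θ : ℕ → Fin K → Ω → ℝ × ℝ)
    (j : ℕ → Ω → Fin K) : Prop where
  measurable_reward : ∀ i n, Measurable (X i n)
  measurable_sample : ∀ t i, Measurable (θ t i)
  measurable_arm : ∀ t, Measurable (j t)
  /-- The rewards of arm `i` follow the uniform distribution with parameters `(μ i, σ i)`. -/
  reward_law : ∀ i n, P.map (X i n) = uniLaw (μ i) (σ i)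
  /-- All rewards are independent. -/
  reward_indep : iIndepFun (fun (p : Fin K × ℕ) => X p.1 p.2) P
  /-- In the first `K * n₀` rounds each arm is played `n₀` times. -/
  initial : ∀ i ω, pulls j i (K * initialPlays k) ω = initialPlays k
  /-- Afterwards, given the past, the parameters of the arms are sampled independently, those of
  arm `i` from its posterior given the rewards observed from arm `i` so far; in particular the
  sampling does not depend on the rewards that have not been observed yet. -/
  sample_law : ∀ t, K * initialPlays k ≤ t → ∀ B : Fin K → Set (ℝ × ℝ),
    (∀ i, MeasurableSet (B i)) →
      P⟦{ω | ∀ i, θ t i ω ∈ B i} | past X θ j t⟧ =ᵐ[P]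
        fun ω => ∏ i, (posterior k (pulls j i t ω) (fun n => X i n ω)).real (B i)
  /-- Then an arm with the largest sampled location is played. -/
  play_max : ∀ t, K * initialPlays k ≤ t → ∀ ω i, (θ t i ω).1 ≤ (θ t (j t ω) ω).1

/-- The sub-optimality gap of arm `i`, where `a` is the optimal arm. -/
def gap {K : ℕ} (μ : Fin K → ℝ) (a i : Fin K) : ℝ := μ a - μ i

/-- The largest gap of the arms other than `a`. -/
def maxGap {K : ℕ} (μ : Fin K → ℝ) (a : Fin K) : ℝ := ⨆ i : {i : Fin K // i ≠ a}, gap μ a i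

/-- The regret after `T` rounds. -/
def regret {Ω : Type*} {K : ℕ} (μ : Fin K → ℝ) (a : Fin K) (j : ℕ → Ω → Fin K) (T : ℕ)
    (ω : Ω) : ℝ :=
  ∑ t ∈ Finset.range T, gap μ a (j t ω)

/-- The expected regret after `T` rounds. -/
def expRegret {Ω : Type*} [MeasurableSpace Ω] (P : Measure Ω) {K : ℕ} (μ : Fin K → ℝ)
    (a : Fin K) (j : ℕ → Ω → Fin K) (T : ℕ) : ℝ :=
  ∫ ω, regret μ a j T ω ∂P

/-- The constant `C(ε, k, s)`. -/
def constC (ε k s : ℝ) : ℝ :=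
  1 + 9 * s / ε + 3 / (16 * (1 - k)) * (s ^ 2 / ε ^ 2) * (2 * Real.exp (2 * ε / s) - 1)

/-- The infimum of the Kullback-Leibler divergences from the law of arm `i` to the uniform
distributions with mean larger than the mean of arm `a`. -/
def klInf {K : ℕ} (μ σ : Fin K → ℝ) (a i : Fin K) : ℝ≥0∞ :=
  ⨅ (m : ℝ) (s : ℝ) (_ : 0 < s) (_ : μ a < m),
    InformationTheory.klDiv (uniLaw (μ i) (σ i)) (uniLaw m s)

end UniformBandit

end

/-! After `n` observations the marginal posterior of the location depends only on the smallest and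
the largest of them. Its density is a power of the least compatible scale, so it is symmetric about
the midrange and its tails have closed forms (`posterior_real_Ioi`, `posterior_real_Iic`). Fix the
threshold `c = μ a - 3 / 2 * ε` and split the plays of a suboptimal arm `i` according to whether all
sampled locations are at most `c`.

If they are not, arm `i` itself sampled a location above `c`. Beyond about `log T / log (1 + (2 *
gap μ a i - 4 * ε) / σ i)` plays this has posterior probability at most `1 / (2 * T)`, unless the
midrange of arm `i` is too high, which is geometrically unlikely (`sum_measure_arm_le`).

If they are, arm `a` was underestimated. Given the past, moving the sample of arm `a` from below `c`
to above it costs the posterior odds, and the new event forces arm `a` to be played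
(`measure_forall_sample_le`). Each play raises the count of arm `a`, so the expected number of such
rounds is at most the sum over `n` of the expected odds after `n` observations
(`sum_lintegral_pulls_le`). The past contains the whole table of rewards, so these expectations
concern i.i.d. samples and the policy drops out. They are computed by integrating over the two
extreme observations; the power of the range that remains is `-k`, integrable at zero because `k <
1` (`lintegral_oddsKernel_inner`).

Dividing by `log T` and then letting `ε` tend to zero gives the asymptotic rate, whose constant is
identified in `klInf_eq`. -/

noncomputable section

namespace UniformBandit

/-! ### Extreme observations -/

/-- The smallest of the first `n` observations, for `1 ≤ n`. -/
def lo (x : ℕ → ℝ) : ℕ → ℝ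
  | 0 => x 0
  | n + 1 => min (lo x n) (x n)

/-- The largest of the first `n` observations, for `1 ≤ n`. -/
def hi (x : ℕ → ℝ) : ℕ → ℝ
  | 0 => x 0
  | n + 1 => max (hi x n) (x n)

lemma lo_le (x : ℕ → ℝ) {n r : ℕ} (h : r < n) : lo x n ≤ x r := by
  induction n with
  | zero => omega
  | succ n ih =>
    rcases Nat.lt_succ_iff_lt_or_eq.1 h with h | rfl
    · exact (min_le_left _ _).trans (ih h)
    · exact min_le_right _ _

lemma le_hi (x : ℕ → ℝ) {n r : ℕ} (h : r < n) : x r ≤ hi x n := by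
  induction n with
  | zero => omega
  | succ n ih =>
    rcases Nat.lt_succ_iff_lt_or_eq.1 h with h | rfl
    · exact (ih h).trans (le_max_left _ _)
    · exact le_max_right _ _

lemma exists_lo_eq (x : ℕ → ℝ) {n : ℕ} (hn : 1 ≤ n) : ∃ r < n, lo x n = x r := by
  induction n, hn using Nat.le_induction with
  | base => exact ⟨0, one_pos, by simp [lo]⟩
  | succ n _ ih =>
    obtain ⟨r, hr, h⟩ := ih
    rcases le_total (lo x n) (x n) with h' | h'
    · exact ⟨r, hr.trans n.lt_succ_self, by rw [lo, min_eq_left h', h]⟩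
    · exact ⟨n, n.lt_succ_self, by rw [lo, min_eq_right h']⟩

lemma exists_hi_eq (x : ℕ → ℝ) {n : ℕ} (hn : 1 ≤ n) : ∃ r < n, hi x n = x r := by
  induction n, hn using Nat.le_induction with
  | base => exact ⟨0, one_pos, by simp [hi]⟩
  | succ n _ ih =>
    obtain ⟨r, hr, h⟩ := ih
    rcases le_total (hi x n) (x n) with h' | h'
    · exact ⟨n, n.lt_succ_self, by rw [hi, max_eq_right h']⟩
    · exact ⟨r, hr.trans n.lt_succ_self, by rw [hi, max_eq_left h', h]⟩

lemma lo_lt_hi (x : ℕ → ℝ) {n : ℕ} (hn : 2 ≤ n) (hx : x 0 ≠ x 1) : lo x n < hi x n := by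
  have h0 := lo_le x (show 0 < n by omega)
  have h1 := lo_le x (show 1 < n by omega)
  have h0' := le_hi x (show 0 < n by omega)
  have h1' := le_hi x (show 1 < n by omega)
  by_contra! h
  exact hx (by linarith)

/-! ### Closed forms for the posterior of the location -/

lemma measurable_uniPdf : Measurable fun q : ℝ × ℝ × ℝ => uniPdf q.1 q.2.1 q.2.2 := by
  unfold uniPdf
  refine Measurable.ite ?_ (by fun_prop) (by fun_prop)
  exact (measurableSet_le (f := fun q : ℝ × ℝ × ℝ => q.1 - q.2.1 / 2) (g := fun q => q.2.2)
    (by fun_prop) (by fun_prop)).inter (measurableSet_le (f := fun q : ℝ × ℝ × ℝ => q.2.2)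
      (g := fun q => q.1 + q.2.1 / 2) (by fun_prop) (by fun_prop))

lemma measurable_posteriorWeight (k : ℝ) (n : ℕ) (x : ℕ → ℝ) :
    Measurable (posteriorWeight k n x) := by
  unfold posteriorWeight
  refine Measurable.ite (measurableSet_lt (by fun_prop) (by fun_prop)) ?_ (by fun_prop)
  refine ENNReal.measurable_ofReal.comp (Measurable.mul (by fun_prop) ?_)
  refine Finset.measurable_prod _ fun r _ => ?_
  exact measurable_uniPdf.comp (by fun_prop : Measurable fun p : ℝ × ℝ => (p.1, p.2, x r))

/-- The smallest scale for which the first `n` observations are possible with location `m`. -/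
def minScale (x : ℕ → ℝ) (n : ℕ) (m : ℝ) : ℝ := 2 * max (hi x n - m) (m - lo x n)

lemma minScale_pos {n : ℕ} {x : ℕ → ℝ} (hx : lo x n < hi x n) (m : ℝ) : 0 < minScale x n m := by
  unfold minScale
  have h1 := le_max_left (hi x n - m) (m - lo x n)
  have h2 := le_max_right (hi x n - m) (m - lo x n)
  linarith

/-- The likelihood is `s ^ (-n)` once the interval with centre `m` and length `s` contains both
extreme observations, and zero before that. -/
lemma posteriorWeight_eq (k : ℝ) {n : ℕ} (hn : 1 ≤ n) {x : ℕ → ℝ} (hx : lo x n < hi x n)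
    (m s : ℝ) : posteriorWeight k n x (m, s) =
      (Set.Ici (minScale x n m)).indicator (fun s => ENNReal.ofReal (s ^ (-(n + k)))) s := by
  have hpos := minScale_pos hx m
  unfold posteriorWeight
  by_cases h : minScale x n m ≤ s
  · have hs : 0 < s := hpos.trans_le h
    have hmax : max (hi x n - m) (m - lo x n) ≤ s / 2 := by unfold minScale at h; linarith
    have h1 := (le_max_left _ _).trans hmax
    have h2 := (le_max_right _ _).trans hmax
    have hp : ∀ r ∈ Finset.range n, uniPdf m s (x r) = 1 / s := by
      intro r hr
      rw [Finset.mem_range] at hr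
      have h3 := lo_le x hr
      have h4 := le_hi x hr
      exact if_pos ⟨by linarith, by linarith⟩
    rw [Set.indicator_of_mem (Set.mem_Ici.2 h), if_pos hs, Finset.prod_congr rfl hp]
    congr 1
    simp only [Finset.prod_const, Finset.card_range, one_div, inv_pow]
    rw [neg_add, Real.rpow_add hs, Real.rpow_neg hs.le, Real.rpow_neg hs.le (n : ℝ),
      Real.rpow_natCast, mul_comm]
  · rw [Set.indicator_of_notMem (by simpa using h)]
    split_ifs with hs
    · have : ∃ r ∈ Finset.range n, uniPdf m s (x r) = 0 := by
        push Not at h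
        unfold minScale at h
        rcases le_total (hi x n - m) (m - lo x n) with h' | h'
        · rw [max_eq_right h'] at h
          obtain ⟨r, hr, he⟩ := exists_lo_eq x hn
          exact ⟨r, Finset.mem_range.2 hr, if_neg fun hc => by linarith [hc.1]⟩
        · rw [max_eq_left h'] at h
          obtain ⟨r, hr, he⟩ := exists_hi_eq x hn
          exact ⟨r, Finset.mem_range.2 hr, if_neg fun hc => by linarith [hc.2]⟩
      obtain ⟨r, hr, h0⟩ := this
      rw [Finset.prod_eq_zero hr h0, mul_zero, ENNReal.ofReal_zero]
    · rfl

lemma lintegral_Ici_rpow {d r : ℝ} (hd : 0 < d) (hr : 0 < r) :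
    ∫⁻ y in Set.Ici d, ENNReal.ofReal (y ^ (-(r + 1))) = ENNReal.ofReal (d ^ (-r) / r) := by
  rw [setLIntegral_congr Ioi_ae_eq_Ici.symm, ← ofReal_integral_eq_lintegral_ofReal]
  · rw [integral_Ioi_rpow_of_lt (by linarith) hd]
    congr 1
    rw [show -(r + 1) + 1 = -r by ring, neg_div_neg_eq]
  · exact integrableOn_Ioi_rpow_of_lt (by linarith) hd
  · filter_upwards [ae_restrict_mem measurableSet_Ioi] with y hy
    exact Real.rpow_nonneg (hd.trans hy).le _

lemma lintegral_Ici_two_mul_rpow {d r : ℝ} (hd : 0 < d) (hr : 0 < r) :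
    ∫⁻ y in Set.Ici d, ENNReal.ofReal ((2 * y) ^ (-(r + 1))) =
      ENNReal.ofReal ((2 * d) ^ (-r) / (2 * r)) := by
  have : ∀ y ∈ Set.Ici d, ENNReal.ofReal ((2 * y) ^ (-(r + 1))) =
      ENNReal.ofReal (2 ^ (-(r + 1))) * ENNReal.ofReal (y ^ (-(r + 1))) := by
    intro y hy
    rw [Real.mul_rpow zero_le_two (hd.le.trans hy), ENNReal.ofReal_mul (by positivity)]
  rw [setLIntegral_congr_fun measurableSet_Ici this, lintegral_const_mul _ (by fun_prop),
    lintegral_Ici_rpow hd hr, ← ENNReal.ofReal_mul (by positivity)]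
  congr 1
  rw [Real.mul_rpow zero_le_two hd.le, neg_add, Real.rpow_add two_pos, Real.rpow_neg_one]
  ring

section posterior
variable {k : ℝ} {n : ℕ} {x : ℕ → ℝ}

/-- Integrating out the scale lowers the exponent `n + k` by one. The result is written `(n + k - 2)
+ 1` because the integration over the location lowers it once more; positivity of `n + k - 2` makes
the posterior proper. -/
lemma unnormalizedPosterior_fst (hn : 1 ≤ n) (hk : 0 < n + k - 2) (hx : lo x n < hi x n)
    {S : Set ℝ} (hS : MeasurableSet S) :
    unnormalizedPosterior k n x (Prod.fst ⁻¹' S) = (ENNReal.ofReal (n + k - 1))⁻¹ *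
      ∫⁻ m in S, ENNReal.ofReal (minScale x n m ^ (-((n + k - 2) + 1))) := by
  have hk1 : (0 : ℝ) < n + k - 1 := by linarith
  rw [unnormalizedPosterior, withDensity_apply _ (measurable_fst hS),
    show Prod.fst ⁻¹' S = S ×ˢ (Set.univ : Set ℝ) by ext; simp, Measure.volume_eq_prod,
    setLIntegral_prod _ (measurable_posteriorWeight k n x).aemeasurable]
  rw [← lintegral_const_mul]
  · refine setLIntegral_congr_fun hS fun m _ => ?_
    simp only [Measure.restrict_univ]
    simp_rw [posteriorWeight_eq k hn hx]
    rw [lintegral_indicator measurableSet_Ici, show (n : ℝ) + k = (n + k - 1) + 1 by ring,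
      lintegral_Ici_rpow (minScale_pos hx m) hk1, div_eq_inv_mul,
      ENNReal.ofReal_mul (by positivity), ENNReal.ofReal_inv_of_pos hk1]
    congr 3
    · ring_nf
    · ring_nf
  · unfold minScale
    fun_prop

/-- To the right of the midrange `minScale x n m` is `2 * (m - lo x n)`, so a translation leaves the
integral of a pure power. -/
lemma unnormalizedPosterior_Ici (hn : 1 ≤ n) (hk : 0 < n + k - 2) (hx : lo x n < hi x n)
    {c : ℝ} (hc : lo x n + hi x n ≤ 2 * c) :
    unnormalizedPosterior k n x (Prod.fst ⁻¹' Set.Ici c) = (ENNReal.ofReal (n + k - 1))⁻¹ *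
      ENNReal.ofReal ((2 * (c - lo x n)) ^ (-(n + k - 2)) / (2 * (n + k - 2))) := by
  rw [unnormalizedPosterior_fst hn hk hx measurableSet_Ici]
  congr 1
  rw [← lintegral_Ici_two_mul_rpow (by linarith) hk, ← lintegral_indicator measurableSet_Ici,
    ← lintegral_indicator measurableSet_Ici]
  refine Eq.trans ?_ (lintegral_sub_right_eq_self _ (lo x n))
  refine lintegral_congr fun m => ?_
  simp only [Set.indicator, Set.mem_Ici, sub_le_sub_iff_right]
  split_ifs with h
  · rw [minScale, max_eq_right (by linarith)]
  · rfl

lemma unnormalizedPosterior_Iic (hn : 1 ≤ n) (hk : 0 < n + k - 2) (hx : lo x n < hi x n)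
    {c : ℝ} (hc : 2 * c ≤ lo x n + hi x n) :
    unnormalizedPosterior k n x (Prod.fst ⁻¹' Set.Iic c) = (ENNReal.ofReal (n + k - 1))⁻¹ *
      ENNReal.ofReal ((2 * (hi x n - c)) ^ (-(n + k - 2)) / (2 * (n + k - 2))) := by
  rw [unnormalizedPosterior_fst hn hk hx measurableSet_Iic]
  congr 1
  rw [← lintegral_Ici_two_mul_rpow (by linarith) hk, ← lintegral_indicator measurableSet_Iic,
    ← lintegral_indicator measurableSet_Ici]
  refine Eq.trans ?_ (lintegral_sub_left_eq_self _ (hi x n))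
  refine lintegral_congr fun m => ?_
  simp only [Set.indicator, Set.mem_Ici, Set.mem_Iic, sub_le_sub_iff_left]
  split_ifs with h
  · rw [minScale, max_eq_left (by linarith)]
  · rfl

lemma unnormalizedPosterior_Ioi_eq_Ici (hn : 1 ≤ n) (hk : 0 < n + k - 2) (hx : lo x n < hi x n)
    (c : ℝ) : unnormalizedPosterior k n x (Prod.fst ⁻¹' Set.Ioi c) =
      unnormalizedPosterior k n x (Prod.fst ⁻¹' Set.Ici c) := by
  rw [unnormalizedPosterior_fst hn hk hx measurableSet_Ioi,
    unnormalizedPosterior_fst hn hk hx measurableSet_Ici, setLIntegral_congr Ioi_ae_eq_Ici]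

/-- The two tail formulas meet at the midrange, where each gives half of the mass. -/
lemma unnormalizedPosterior_univ (hn : 1 ≤ n) (hk : 0 < n + k - 2) (hx : lo x n < hi x n) :
    unnormalizedPosterior k n x Set.univ = (ENNReal.ofReal (n + k - 1))⁻¹ *
      ENNReal.ofReal ((hi x n - lo x n) ^ (-(n + k - 2)) / (n + k - 2)) := by
  have h : (Set.univ : Set (ℝ × ℝ)) = Prod.fst ⁻¹' Set.Iic ((lo x n + hi x n) / 2) ∪
      Prod.fst ⁻¹' Set.Ioi ((lo x n + hi x n) / 2) := by
    rw [← Set.preimage_union, Set.Iic_union_Ioi, Set.preimage_univ]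
  have hR : 0 < hi x n - lo x n := by linarith
  rw [h, measure_union _ (measurable_fst measurableSet_Ioi),
    unnormalizedPosterior_Ioi_eq_Ici hn hk hx, unnormalizedPosterior_Ici hn hk hx (by linarith),
    unnormalizedPosterior_Iic hn hk hx (by linarith), ← mul_add,
    ← ENNReal.ofReal_add (by apply div_nonneg <;> [apply Real.rpow_nonneg; skip] <;> linarith)
      (by apply div_nonneg <;> [apply Real.rpow_nonneg; skip] <;> linarith)]
  · congr 2
    rw [show 2 * (hi x n - (lo x n + hi x n) / 2) = hi x n - lo x n by ring,
      show 2 * ((lo x n + hi x n) / 2 - lo x n) = hi x n - lo x n by ring]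
    field_simp
    ring
  · exact Disjoint.preimage _ (Set.Iic_disjoint_Ioi le_rfl)

lemma posterior_apply (S : Set (ℝ × ℝ)) : posterior k n x S =
    (unnormalizedPosterior k n x Set.univ)⁻¹ * unnormalizedPosterior k n x S := rfl

lemma posterior_le_one (S : Set (ℝ × ℝ)) : posterior k n x S ≤ 1 := by
  rw [posterior_apply]
  exact (mul_le_mul_right (measure_mono (Set.subset_univ S)) _).trans (ENNReal.inv_mul_le_one _)

lemma posterior_real_le_one (S : Set (ℝ × ℝ)) : (posterior k n x).real S ≤ 1 :=
  ENNReal.toReal_le_of_le_ofReal zero_le_one (by simpa using posterior_le_one S)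

lemma isProbabilityMeasure_posterior (hn : 1 ≤ n) (hk : 0 < n + k - 2) (hx : lo x n < hi x n) :
    IsProbabilityMeasure (posterior k n x) := by
  have hR : 0 < hi x n - lo x n := by linarith
  refine ⟨?_⟩
  rw [posterior_apply, unnormalizedPosterior_univ hn hk hx]
  refine ENNReal.inv_mul_cancel (mul_ne_zero (by simp) ?_) (ENNReal.mul_ne_top ?_ (by simp))
  · simp only [ne_eq, ENNReal.ofReal_eq_zero, not_le]
    positivity
  · simp only [ne_eq, ENNReal.inv_eq_top, ENNReal.ofReal_eq_zero, not_le]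
    linarith

lemma normalize_tail {N A R y : ℝ} (hN : 0 < N) (hA : 0 < A) (hR : 0 < R) (hy : 0 < y) :
    (((ENNReal.ofReal A)⁻¹ * ENNReal.ofReal (R ^ (-N) / N))⁻¹ *
      ((ENNReal.ofReal A)⁻¹ * ENNReal.ofReal (y ^ (-N) / (2 * N)))).toReal =
      1 / 2 * (R / y) ^ N := by
  simp only [ENNReal.toReal_mul, ENNReal.toReal_inv]
  rw [ENNReal.toReal_ofReal hA.le, ENNReal.toReal_ofReal (by positivity),
    ENNReal.toReal_ofReal (by positivity), Real.div_rpow hR.le hy.le, Real.rpow_neg hR.le,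
    Real.rpow_neg hy.le]
  have := Real.rpow_pos_of_pos hR N
  have := Real.rpow_pos_of_pos hy N
  field_simp

lemma posterior_real_Ioi (hn : 1 ≤ n) (hk : 0 < n + k - 2) (hx : lo x n < hi x n)
    {c : ℝ} (hc : lo x n + hi x n ≤ 2 * c) : (posterior k n x).real (Prod.fst ⁻¹' Set.Ioi c) =
      1 / 2 * ((hi x n - lo x n) / (2 * (c - lo x n))) ^ (n + k - 2) := by
  rw [measureReal_def, posterior_apply, unnormalizedPosterior_Ioi_eq_Ici hn hk hx,
    unnormalizedPosterior_Ici hn hk hx hc, unnormalizedPosterior_univ hn hk hx,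
    normalize_tail hk (by linarith) (by linarith) (by linarith)]

lemma posterior_real_Iic (hn : 1 ≤ n) (hk : 0 < n + k - 2) (hx : lo x n < hi x n)
    {c : ℝ} (hc : 2 * c ≤ lo x n + hi x n) : (posterior k n x).real (Prod.fst ⁻¹' Set.Iic c) =
      1 / 2 * ((hi x n - lo x n) / (2 * (hi x n - c))) ^ (n + k - 2) := by
  rw [measureReal_def, posterior_apply,
    unnormalizedPosterior_Iic hn hk hx hc, unnormalizedPosterior_univ hn hk hx,
    normalize_tail hk (by linarith) (by linarith) (by linarith)]

/-- A bound for the posterior odds against a location larger than `c`. -/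
def oddsBound (k c : ℝ) (n : ℕ) (x : ℕ → ℝ) : ℝ :=
  if lo x n + hi x n ≤ 2 * c then
    2 * (2 * (c - lo x n) / (hi x n - lo x n)) ^ (n + k - 2)
  else ((hi x n - lo x n) / (2 * (hi x n - c))) ^ (n + k - 2)

lemma oddsBound_nonneg (hx : lo x n < hi x n) (c : ℝ) : 0 ≤ oddsBound k c n x := by
  have hR : 0 < hi x n - lo x n := by linarith
  unfold oddsBound
  split_ifs with h
  · exact mul_nonneg zero_le_two (Real.rpow_nonneg (div_nonneg (by linarith) hR.le) _)
  · exact Real.rpow_nonneg (div_nonneg hR.le (by linarith)) _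

lemma posterior_real_Iic_le (hn : 1 ≤ n) (hk : 0 < n + k - 2) (hx : lo x n < hi x n) (c : ℝ) :
    (posterior k n x).real (Prod.fst ⁻¹' Set.Iic c) ≤
      oddsBound k c n x * (posterior k n x).real (Prod.fst ⁻¹' Set.Ioi c) := by
  have hP := isProbabilityMeasure_posterior hn hk hx
  have hR : 0 < hi x n - lo x n := by linarith
  have hsum : (posterior k n x).real (Prod.fst ⁻¹' Set.Ioi c) =
      1 - (posterior k n x).real (Prod.fst ⁻¹' Set.Iic c) := by
    rw [← probReal_compl_eq_one_sub (measurable_fst measurableSet_Iic), ← Set.preimage_compl,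
      Set.compl_Iic]
  unfold oddsBound
  split_ifs with h
  -- The left side is bounded by one, and the odds bound is exactly the reciprocal of the upper
  -- tail.
  · rw [posterior_real_Ioi hn hk hx h]
    refine (posterior_real_le_one _).trans (le_of_eq ?_)
    have h2 : 0 < 2 * (c - lo x n) := by linarith
    rw [Real.div_rpow h2.le hR.le, Real.div_rpow hR.le h2.le]
    have := Real.rpow_pos_of_pos hR (n + k - 2)
    have := Real.rpow_pos_of_pos h2 (n + k - 2)
    field_simp
  -- With `q` the power in `oddsBound`, the claim is `q / 2 ≤ q * (1 - q / 2)`, which holds for `0 ≤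
  -- q ≤ 1`.
  · rw [hsum, posterior_real_Iic hn hk hx (by linarith)]
    have h2 : 0 < 2 * (hi x n - c) := by linarith
    have h0 : 0 ≤ ((hi x n - lo x n) / (2 * (hi x n - c))) ^ (n + k - 2) :=
      Real.rpow_nonneg (by positivity) _
    have h1 : ((hi x n - lo x n) / (2 * (hi x n - c))) ^ (n + k - 2) ≤ 1 := by
      refine Real.rpow_le_one (by positivity) ?_ hk.le
      rw [div_le_one h2]
      linarith
    nlinarith

end posterior

/-! ### The uniform law and integrals of powers -/

lemma uniLaw_eq (m s : ℝ) : uniLaw m s =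
    ENNReal.ofReal (1 / s) • volume.restrict (Set.Icc (m - s / 2) (m + s / 2)) := by
  rw [← withDensity_const, ← withDensity_indicator measurableSet_Icc, uniLaw]
  congr 1
  ext x
  simp only [uniPdf, Set.indicator, Set.mem_Icc]
  split_ifs <;> simp

lemma uniLaw_apply_le (m s : ℝ) (S : Set ℝ) :
    uniLaw m s S ≤ ENNReal.ofReal (1 / s) * volume S := by
  rw [uniLaw_eq, Measure.smul_apply, smul_eq_mul]
  gcongr
  exact Measure.restrict_le_self

lemma isProbabilityMeasure_uniLaw (m : ℝ) {s : ℝ} (hs : 0 < s) :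
    IsProbabilityMeasure (uniLaw m s) := by
  refine ⟨?_⟩
  rw [uniLaw_eq, Measure.smul_apply, Measure.restrict_apply_univ, Real.volume_Icc, smul_eq_mul,
    ← ENNReal.ofReal_mul (by positivity)]
  rw [show 1 / s * (m + s / 2 - (m - s / 2)) = 1 by field_simp; ring, ENNReal.ofReal_one]

lemma uniLaw_absolutelyContinuous (m s : ℝ) : uniLaw m s ≪ volume :=
  withDensity_absolutelyContinuous _ _

lemma uniLaw_ae_mem (m s : ℝ) : ∀ᵐ x ∂uniLaw m s, x ∈ Set.Icc (m - s / 2) (m + s / 2) := by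
  rw [uniLaw_eq]
  exact Measure.ae_smul_measure (ae_restrict_mem measurableSet_Icc) _

lemma lintegral_Ioc_rpow {d r : ℝ} (hd : 0 ≤ d) (hr : -1 < r) :
    ∫⁻ y in Set.Ioc 0 d, ENNReal.ofReal (y ^ r) = ENNReal.ofReal (d ^ (r + 1) / (r + 1)) := by
  rw [← ofReal_integral_eq_lintegral_ofReal]
  · rw [← intervalIntegral.integral_of_le hd, integral_rpow (Or.inl hr),
      Real.zero_rpow (by linarith), sub_zero]
  · exact (intervalIntegrable_iff_integrableOn_Ioc_of_le hd).1
      (intervalIntegral.intervalIntegrable_rpow' hr)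
  · filter_upwards [ae_restrict_mem measurableSet_Ioc] with y hy
    exact Real.rpow_nonneg hy.1.le _

lemma lintegral_Ioc_sub_rpow {u d r : ℝ} (hd : u ≤ d) (hr : -1 < r) :
    ∫⁻ v in Set.Ioc u d, ENNReal.ofReal ((v - u) ^ r) =
      ENNReal.ofReal ((d - u) ^ (r + 1) / (r + 1)) := by
  rw [← lintegral_Ioc_rpow (sub_nonneg.2 hd) hr, ← lintegral_indicator measurableSet_Ioc,
    ← lintegral_indicator measurableSet_Ioc]
  refine Eq.trans ?_ (lintegral_sub_right_eq_self _ u)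
  refine lintegral_congr fun v => ?_
  simp only [Set.indicator, Set.mem_Ioc, sub_pos, sub_le_sub_iff_right]

lemma lintegral_Ico_sub_rpow {l c r : ℝ} (hl : l ≤ c) (hr : -1 < r) :
    ∫⁻ u in Set.Ico l c, ENNReal.ofReal ((c - u) ^ r) =
      ENNReal.ofReal ((c - l) ^ (r + 1) / (r + 1)) := by
  rw [← lintegral_Ioc_rpow (sub_nonneg.2 hl) hr, ← lintegral_indicator measurableSet_Ico,
    ← lintegral_indicator measurableSet_Ioc]
  refine Eq.trans ?_ (lintegral_sub_left_eq_self _ c)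
  refine lintegral_congr fun v => ?_
  simp only [Set.indicator, Set.mem_Ico, Set.mem_Ioc, sub_pos, sub_le_sub_iff_left, and_comm]

/-! ### Expected posterior odds of an i.i.d. uniform sample -/

/-- The contribution of the pairs `u < v` of extreme observations to the expected posterior odds
is the integral of this function against `(v - u) ^ (n - 2)`. -/
def oddsKernel (N c l : ℝ) (p : ℝ × ℝ) : ℝ≥0∞ :=
  if l ≤ p.1 ∧ p.1 < p.2 ∧ p.1 + p.2 ≤ 2 * c then
    ENNReal.ofReal ((2 * (c - p.1) / (p.2 - p.1)) ^ N) else 0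

lemma measurable_oddsKernel (N c l : ℝ) : Measurable (oddsKernel N c l) := by
  unfold oddsKernel
  refine Measurable.ite ?_ (by fun_prop) (by fun_prop)
  exact (measurableSet_le measurable_const measurable_fst).inter
    ((measurableSet_lt measurable_fst measurable_snd).inter
    (measurableSet_le (measurable_fst.add measurable_snd) measurable_const))

/-- The factor `(v - u) ^ (n - 2)` cancels against the odds and leaves `(v - u) ^ (-k)` for every
`n`. This is integrable near `v = u` because `k < 1`, and its integral produces the factor `1 / (1 -
k)`. -/
lemma lintegral_oddsKernel_inner {n : ℕ} {k c l u : ℝ} (hk : k < 1) (hn : 2 ≤ n) (hu : l ≤ u) :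
    ∫⁻ v, oddsKernel (n + k - 2) c l (u, v) * ENNReal.ofReal (v - u) ^ (n - 2) =
      (Set.Ico l c).indicator (fun u => ENNReal.ofReal ((2 : ℝ) ^ ((n : ℝ) - 1) / (1 - k)) *
        ENNReal.ofReal ((c - u) ^ ((n : ℝ) - 1))) u := by
  by_cases hc : u < c
  · rw [Set.indicator_of_mem (Set.mem_Ico.2 ⟨hu, hc⟩)]
    have h1 : ∀ v, oddsKernel (n + k - 2) c l (u, v) * ENNReal.ofReal (v - u) ^ (n - 2) =
        (Set.Ioc u (2 * c - u)).indicator (fun v => ENNReal.ofReal ((2 * (c - u)) ^ (n + k - 2)) *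
          ENNReal.ofReal ((v - u) ^ (-k))) v := by
      intro v
      by_cases hv : v ∈ Set.Ioc u (2 * c - u)
      · rw [Set.indicator_of_mem hv, oddsKernel, if_pos ⟨hu, hv.1, by have := hv.2; simp; linarith⟩]
        have hp : 0 < v - u := sub_pos.2 hv.1
        have hp' : 0 < 2 * (c - u) := by linarith
        rw [← ENNReal.ofReal_pow hp.le, ← ENNReal.ofReal_mul (by positivity),
          ← ENNReal.ofReal_mul (by positivity)]
        congr 1
        simp only
        rw [Real.div_rpow hp'.le hp.le, ← Real.rpow_natCast, Nat.cast_sub hn, div_mul_eq_mul_div,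
          mul_div_assoc, ← Real.rpow_sub hp]
        congr 2
        push_cast
        ring
      · rw [Set.indicator_of_notMem hv, oddsKernel, if_neg, zero_mul]
        rintro ⟨-, h, h'⟩
        exact hv ⟨h, by simp at h'; linarith⟩
    rw [lintegral_congr h1, lintegral_indicator measurableSet_Ioc,
      lintegral_const_mul _ (by fun_prop), lintegral_Ioc_sub_rpow (by linarith) (by linarith),
      ← ENNReal.ofReal_mul (by positivity [sub_pos.2 hc]), ← ENNReal.ofReal_mul
        (div_nonneg (by positivity) (by linarith))]
    congr 1
    have hp : 0 < c - u := sub_pos.2 hc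
    have hp' : 0 < 2 * (c - u) := by linarith
    rw [show 2 * c - u - u = 2 * (c - u) by ring, mul_div_assoc', ← Real.rpow_add hp',
      show (n : ℝ) + k - 2 + (-k + 1) = n - 1 by ring, Real.mul_rpow zero_le_two hp.le]
    rw [show -k + 1 = 1 - k by ring]
    ring
  · rw [Set.indicator_of_notMem (fun h => hc h.2)]
    refine (lintegral_congr fun v => ?_).trans lintegral_zero
    rw [oddsKernel, if_neg, zero_mul]
    rintro ⟨-, h, h'⟩
    simp at h h'
    linarith

/-- The power of `uniLaw` is the chance that the other `n - 2` observations fall between the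
extremes; together with the two densities it contributes `(1 / s) ^ n`. The `max 0` covers a `c`
below the support, where no pair qualifies. -/
lemma lintegral_oddsKernel {n : ℕ} {k c m s : ℝ} (hs : 0 < s) (hk : k < 1) (hn : 2 ≤ n) :
    ∫⁻ p, oddsKernel (n + k - 2) c (m - s / 2) p * uniLaw m s (Set.Icc p.1 p.2) ^ (n - 2)
      ∂((uniLaw m s).prod (uniLaw m s)) ≤
      ENNReal.ofReal (max 0 ((2 * (c - m) + s) / s) ^ n / (2 * n * (1 - k))) := by
  have := isProbabilityMeasure_uniLaw m hs
  have hn0 : (2 : ℝ) ≤ n := by exact_mod_cast hn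
  have hk' : 0 < 1 - k := by linarith
  set l := m - s / 2 with hl
  set A := ENNReal.ofReal (1 / s) with hA
  have hmeas : Measurable fun p : ℝ × ℝ =>
      oddsKernel (n + k - 2) c l p * (A * ENNReal.ofReal (p.2 - p.1)) ^ (n - 2) :=
    (measurable_oddsKernel _ _ _).mul (by fun_prop)
  have hmeas' : Measurable fun p : ℝ × ℝ =>
      oddsKernel (n + k - 2) c l p * ENNReal.ofReal (p.2 - p.1) ^ (n - 2) :=
    (measurable_oddsKernel _ _ _).mul (by fun_prop)
  have hle : ∀ f : ℝ → ℝ≥0∞, ∫⁻ v, f v ∂uniLaw m s ≤ A * ∫⁻ v, f v := by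
    intro f
    rw [uniLaw_eq, lintegral_smul_measure, smul_eq_mul]
    gcongr
    exact Measure.restrict_le_self
  calc _ ≤ ∫⁻ p, oddsKernel (n + k - 2) c l p * (A * ENNReal.ofReal (p.2 - p.1)) ^ (n - 2)
        ∂((uniLaw m s).prod (uniLaw m s)) := by
        refine lintegral_mono fun p => ?_
        gcongr
        exact (uniLaw_apply_le m s _).trans_eq (by rw [Real.volume_Icc])
    _ = ∫⁻ u, ∫⁻ v, oddsKernel (n + k - 2) c l (u, v) *
        (A * ENNReal.ofReal (v - u)) ^ (n - 2) ∂uniLaw m s ∂uniLaw m s :=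
        lintegral_prod _ hmeas.aemeasurable
    _ ≤ ∫⁻ u, A ^ (n - 1) * (Set.Ico l c).indicator (fun u =>
          ENNReal.ofReal ((2 : ℝ) ^ ((n : ℝ) - 1) / (1 - k)) *
          ENNReal.ofReal ((c - u) ^ ((n : ℝ) - 1))) u ∂uniLaw m s := by
        refine lintegral_mono_ae ?_
        filter_upwards [uniLaw_ae_mem m s] with u hu
        refine (hle _).trans_eq ?_
        rw [← lintegral_oddsKernel_inner hk hn hu.1, ← lintegral_const_mul, ← lintegral_const_mul]
        · refine lintegral_congr fun v => ?_
          rw [mul_pow, show n - 1 = (n - 2) + 1 by omega, pow_succ]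
          ring
        · exact hmeas'.comp (by fun_prop : Measurable fun v : ℝ => (u, v))
        · exact hmeas.comp (by fun_prop : Measurable fun v : ℝ => (u, v))
    _ ≤ A * ∫⁻ u, A ^ (n - 1) * (Set.Ico l c).indicator (fun u =>
          ENNReal.ofReal ((2 : ℝ) ^ ((n : ℝ) - 1) / (1 - k)) *
          ENNReal.ofReal ((c - u) ^ ((n : ℝ) - 1))) u := hle _
    _ = A ^ n * ENNReal.ofReal ((2 : ℝ) ^ ((n : ℝ) - 1) / (1 - k)) *
          ∫⁻ u in Set.Ico l c, ENNReal.ofReal ((c - u) ^ ((n : ℝ) - 1)) := by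
        have hg : Measurable fun u => ENNReal.ofReal ((2 : ℝ) ^ ((n : ℝ) - 1) / (1 - k)) *
          ENNReal.ofReal ((c - u) ^ ((n : ℝ) - 1)) := by fun_prop
        rw [lintegral_const_mul _ (hg.indicator measurableSet_Ico),
          lintegral_indicator measurableSet_Ico, lintegral_const_mul _ (by fun_prop),
          ← mul_assoc, ← pow_succ', Nat.sub_add_cancel (by omega), mul_assoc]
    _ ≤ _ := by
        rcases le_total l c with hlc | hlc
        · rw [lintegral_Ico_sub_rpow hlc (by linarith), hA, ← ENNReal.ofReal_pow (by positivity),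
            ← ENNReal.ofReal_mul (by positivity), ← ENNReal.ofReal_mul (by positivity)]
          refine ENNReal.ofReal_le_ofReal (le_of_eq ?_)
          have h2 : 2 * (c - m) + s = 2 * (c - l) := by rw [hl]; ring
          rw [max_eq_right (div_nonneg (by linarith) hs.le), h2, sub_add_cancel, Real.rpow_sub_one
            two_ne_zero, Real.rpow_natCast, Real.rpow_natCast, div_pow, div_pow, mul_pow]
          field_simp
          rw [one_pow, one_mul]
        · rw [Set.Ico_eq_empty (not_lt.2 hlc)]
          simp

lemma uniLaw_Ioi_le {m s : ℝ} (hs : 0 < s) (d : ℝ) :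
    uniLaw m s (Set.Ioi (m - s / 2 + d)) ≤ ENNReal.ofReal (max 0 (1 - d / s)) := by
  rw [uniLaw_eq, Measure.smul_apply, Measure.restrict_apply measurableSet_Ioi, smul_eq_mul]
  calc _ ≤ ENNReal.ofReal (1 / s) * volume (Set.Icc (m - s / 2 + d) (m + s / 2)) := by
        gcongr
        exact fun x hx => ⟨(Set.mem_Ioi.1 hx.1).le, hx.2.2⟩
    _ ≤ _ := by
        rw [Real.volume_Icc, ← ENNReal.ofReal_mul (by positivity)]
        refine ENNReal.ofReal_le_ofReal (le_trans (le_of_eq ?_) (le_max_right _ _))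
        field_simp
        ring

lemma uniLaw_Iic_le {m s : ℝ} (hs : 0 < s) (d : ℝ) :
    uniLaw m s (Set.Iic (m + s / 2 - d)) ≤ ENNReal.ofReal (max 0 (1 - d / s)) := by
  rw [uniLaw_eq, Measure.smul_apply, Measure.restrict_apply measurableSet_Iic, smul_eq_mul]
  calc _ ≤ ENNReal.ofReal (1 / s) * volume (Set.Icc (m - s / 2) (m + s / 2 - d)) := by
        gcongr
        exact fun x hx => ⟨hx.2.1, Set.mem_Iic.1 hx.1⟩
    _ ≤ _ := by
        rw [Real.volume_Icc, ← ENNReal.ofReal_mul (by positivity)]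
        refine ENNReal.ofReal_le_ofReal (le_trans (le_of_eq ?_) (le_max_right _ _))
        field_simp
        ring

section sample

variable {Ω : Type*} [MeasurableSpace Ω] {P : Measure Ω} {Y : ℕ → Ω → ℝ} {m s : ℝ}

lemma ae_mem_Icc (hY : ∀ n, Measurable (Y n)) (hlaw : ∀ n, P.map (Y n) = uniLaw m s) :
    ∀ᵐ ω ∂P, ∀ n, Y n ω ∈ Set.Icc (m - s / 2) (m + s / 2) := by
  refine ae_all_iff.2 fun n => ae_of_ae_map (hY n).aemeasurable ?_
  rw [hlaw n]
  exact uniLaw_ae_mem m s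

lemma measure_forall_mem (hY : ∀ n, Measurable (Y n)) (hlaw : ∀ n, P.map (Y n) = uniLaw m s)
    (hind : iIndepFun Y P) (F : Finset ℕ) {S : Set ℝ} (hS : MeasurableSet S) :
    P {ω | ∀ r ∈ F, Y r ω ∈ S} = uniLaw m s S ^ F.card := by
  have h := hind.measure_inter_preimage_eq_mul F (sets := fun _ => S) fun _ _ => hS
  rw [show {ω | ∀ r ∈ F, Y r ω ∈ S} = ⋂ i ∈ F, Y i ⁻¹' S by ext; simp, h,
    Finset.prod_congr rfl fun r _ => by rw [← Measure.map_apply (hY r) hS, hlaw],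
    Finset.prod_const]

/-- Almost surely the maximum is at most `m + s / 2`, so a midrange above `m + e` pushes the
minimum, hence every observation, above `m - s / 2 + 2 * e`. -/
lemma measure_midrange_gt_le (hs : 0 < s) (hY : ∀ n, Measurable (Y n))
    (hlaw : ∀ n, P.map (Y n) = uniLaw m s) (hind : iIndepFun Y P) {n : ℕ} (hn : 1 ≤ n) (e : ℝ) :
    P {ω | 2 * (m + e) < lo (Y · ω) n + hi (Y · ω) n} ≤
      ENNReal.ofReal (max 0 (1 - 2 * e / s) ^ n) := by
  rw [ENNReal.ofReal_pow (le_max_left _ _)]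
  calc _ ≤ P {ω | ∀ r ∈ Finset.range n, Y r ω ∈ Set.Ioi (m - s / 2 + 2 * e)} := by
        refine measure_mono_ae ?_
        filter_upwards [ae_mem_Icc hY hlaw] with ω hω h r hr
        obtain ⟨q, hq, he⟩ := exists_hi_eq (Y · ω) hn
        have h1 := (hω q).2
        have h2 := lo_le (Y · ω) (Finset.mem_range.1 hr)
        have h3 : 2 * (m + e) < lo (Y · ω) n + hi (Y · ω) n := h
        simp only [Set.mem_Ioi]
        linarith
    _ ≤ _ := by
        rw [measure_forall_mem hY hlaw hind _ measurableSet_Ioi, Finset.card_range]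
        gcongr
        exact uniLaw_Ioi_le hs _

lemma measure_midrange_le_le (hs : 0 < s) (hY : ∀ n, Measurable (Y n))
    (hlaw : ∀ n, P.map (Y n) = uniLaw m s) (hind : iIndepFun Y P) {n : ℕ} (hn : 1 ≤ n) (e : ℝ) :
    P {ω | lo (Y · ω) n + hi (Y · ω) n ≤ 2 * (m - e)} ≤
      ENNReal.ofReal (max 0 (1 - 2 * e / s) ^ n) := by
  rw [ENNReal.ofReal_pow (le_max_left _ _)]
  calc _ ≤ P {ω | ∀ r ∈ Finset.range n, Y r ω ∈ Set.Iic (m + s / 2 - 2 * e)} := by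
        refine measure_mono_ae ?_
        filter_upwards [ae_mem_Icc hY hlaw] with ω hω h r hr
        obtain ⟨q, hq, he⟩ := exists_lo_eq (Y · ω) hn
        have h1 := (hω q).1
        have h2 := le_hi (Y · ω) (Finset.mem_range.1 hr)
        have h3 : lo (Y · ω) n + hi (Y · ω) n ≤ 2 * (m - e) := h
        simp only [Set.mem_Iic]
        linarith
    _ ≤ _ := by
        rw [measure_forall_mem hY hlaw hind _ measurableSet_Iic, Finset.card_range]
        gcongr
        exact uniLaw_Iic_le hs _

variable [IsProbabilityMeasure P]

lemma map_pair (hY : ∀ n, Measurable (Y n)) (hlaw : ∀ n, P.map (Y n) = uniLaw m s)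
    (hind : iIndepFun Y P) {p q : ℕ} (hpq : p ≠ q) :
    P.map (fun ω => (Y p ω, Y q ω)) = (uniLaw m s).prod (uniLaw m s) := by
  rw [(hind.indepFun hpq).map_prod_eq_prod_map_map (hY p).aemeasurable (hY q).aemeasurable,
    hlaw, hlaw]

lemma ae_ne (hs : 0 < s) (hY : ∀ n, Measurable (Y n)) (hlaw : ∀ n, P.map (Y n) = uniLaw m s)
    (hind : iIndepFun Y P) {p q : ℕ} (hpq : p ≠ q) : ∀ᵐ ω ∂P, Y p ω ≠ Y q ω := by
  have := isProbabilityMeasure_uniLaw m hs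
  have h : ∀ᵐ z ∂(P.map fun ω => (Y p ω, Y q ω)), z.1 ≠ z.2 := by
    rw [map_pair hY hlaw hind hpq]
    have hmeas : MeasurableSet {z : ℝ × ℝ | z.1 ≠ z.2} :=
      (measurableSet_eq_fun measurable_fst measurable_snd).compl
    refine Measure.ae_prod_iff_ae_ae hmeas |>.2 (ae_of_all _ fun u => ?_)
    refine (uniLaw_absolutelyContinuous m s).ae_le ?_
    filter_upwards [compl_mem_ae_iff.2 (measure_singleton u)] with v hv
    exact fun h => hv h.symm
  exact ae_of_ae_map ((hY p).prodMk (hY q)).aemeasurable h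

/-- Fubini: the pair is independent of the observations indexed by `F`, so for fixed endpoints the
indicator integrates to a product of equal probabilities. -/
lemma lintegral_pair_mul_indicator (hs : 0 < s) (hY : ∀ n, Measurable (Y n))
    (hlaw : ∀ n, P.map (Y n) = uniLaw m s) (hind : iIndepFun Y P) {p q : ℕ} (hpq : p ≠ q)
    (F : Finset ℕ) (hp : p ∉ F) (hq : q ∉ F) {f : ℝ × ℝ → ℝ≥0∞} (hf : Measurable f) :
    ∫⁻ ω, f (Y p ω, Y q ω) *
      {ω | ∀ r ∈ F, Y r ω ∈ Set.Icc (Y p ω) (Y q ω)}.indicator 1 ω ∂P =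
    ∫⁻ z, f z * uniLaw m s (Set.Icc z.1 z.2) ^ F.card ∂((uniLaw m s).prod (uniLaw m s)) := by
  have := isProbabilityMeasure_uniLaw m hs
  let W : Ω → ℝ × ℝ := fun ω => (Y p ω, Y q ω)
  let Z : Ω → F → ℝ := fun ω r => Y r ω
  have hW : Measurable W := (hY p).prodMk (hY q)
  have hZ : Measurable Z := measurable_pi_lambda _ fun r => hY r
  let D : Set ((ℝ × ℝ) × (F → ℝ)) := {y | ∀ r, y.2 r ∈ Set.Icc y.1.1 y.1.2}
  have hD : MeasurableSet D := by
    have : D = ⋂ r : F, {y | y.1.1 ≤ y.2 r} ∩ {y | y.2 r ≤ y.1.2} := by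
      ext y; simp [D]
    rw [this]
    exact MeasurableSet.iInter fun r =>
      (measurableSet_le (by fun_prop) (by fun_prop)).inter
        (measurableSet_le (by fun_prop) (by fun_prop))
  have hWZ : IndepFun W Z P := by
    have hdisj : Disjoint ({p, q} : Finset ℕ) F := by
      simp [Finset.disjoint_insert_left, hp, hq]
    have h := hind.indepFun_finset {p, q} F hdisj hY
    exact h.comp (φ := fun g : ({p, q} : Finset ℕ) → ℝ => (g ⟨p, by simp⟩, g ⟨q, by simp⟩)) (ψ := id)
      (by fun_prop) measurable_id
  have hG : Measurable fun y : (ℝ × ℝ) × (F → ℝ) => f y.1 * D.indicator 1 y :=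
    (hf.comp measurable_fst).mul (measurable_one.indicator hD)
  calc _ = ∫⁻ ω, (fun y : (ℝ × ℝ) × (F → ℝ) => f y.1 * D.indicator 1 y) (W ω, Z ω) ∂P := by
        refine lintegral_congr fun ω => ?_
        congr 1
        simp only [Set.indicator, D, W, Z, Set.mem_ofPred_eq, Subtype.forall]
        congr 1
    _ = ∫⁻ z, ∫⁻ y, f z * D.indicator 1 (z, y) ∂(P.map Z) ∂(P.map W) := by
        rw [← lintegral_map hG (hW.prodMk hZ), hWZ.map_prod_eq_prod_map_map hW.aemeasurable
          hZ.aemeasurable, lintegral_prod _ hG.aemeasurable]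
    _ = _ := by
        rw [map_pair hY hlaw hind hpq]
        refine lintegral_congr fun z => ?_
        have hDz : MeasurableSet (Prod.mk z ⁻¹' D) := measurable_prodMk_left hD
        have hm : Measurable fun y => D.indicator (1 : (ℝ × ℝ) × (F → ℝ) → ℝ≥0∞) (z, y) :=
          (measurable_one.indicator hD).comp measurable_prodMk_left
        rw [lintegral_const_mul _ hm]
        congr 1
        rw [show (fun y => D.indicator (1 : (ℝ × ℝ) × (F → ℝ) → ℝ≥0∞) (z, y)) = (Prod.mk z ⁻¹' D).indicator 1 from
          rfl, lintegral_indicator_one hDz, Measure.map_apply hZ hDz,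
          ← measure_forall_mem hY hlaw hind F measurableSet_Icc]
        congr 1
        ext ω
        simp [D, Z]

/-- The integrand is bounded by the sum over ordered pairs of indices, one of which locates the
minimum and the maximum. There are at most `n ^ 2` pairs, each controlled by `lintegral_oddsKernel`.
-/
lemma lintegral_odds_le (hs : 0 < s) (hY : ∀ n, Measurable (Y n))
    (hlaw : ∀ n, P.map (Y n) = uniLaw m s) (hind : iIndepFun Y P) {n : ℕ} (hn : 2 ≤ n)
    {k : ℝ} (hk : k < 1) (c : ℝ) :
    ∫⁻ ω, (if lo (Y · ω) n + hi (Y · ω) n ≤ 2 * c then ENNReal.ofReal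
        ((2 * (c - lo (Y · ω) n) / (hi (Y · ω) n - lo (Y · ω) n)) ^ (n + k - 2)) else 0) ∂P ≤
      ENNReal.ofReal (n * max 0 ((2 * (c - m) + s) / s) ^ n / (2 * (1 - k))) := by
  have hn0 : (2 : ℝ) ≤ n := by exact_mod_cast hn
  have hk' : 0 < 1 - k := by linarith
  let I : Finset (ℕ × ℕ) := (Finset.range n).offDiag
  let F : ℕ × ℕ → Finset ℕ := fun p => Finset.range n \ {p.1, p.2}
  let f := oddsKernel (n + k - 2) c (m - s / 2)
  let D : ℕ × ℕ → Set Ω := fun p => {ω | ∀ r ∈ F p, Y r ω ∈ Set.Icc (Y p.1 ω) (Y p.2 ω)}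
  have hD : ∀ p, MeasurableSet (D p) := by
    intro p
    have : D p = ⋂ r ∈ F p, {ω | Y p.1 ω ≤ Y r ω} ∩ {ω | Y r ω ≤ Y p.2 ω} := by
      ext ω; simp [D]
    rw [this]
    exact Finset.measurableSet_biInter _ fun r _ =>
      (measurableSet_le (hY _) (hY _)).inter (measurableSet_le (hY _) (hY _))
  calc _ ≤ ∫⁻ ω, ∑ p ∈ I, f (Y p.1 ω, Y p.2 ω) * (D p).indicator 1 ω ∂P := by
        refine lintegral_mono_ae ?_
        filter_upwards [ae_mem_Icc hY hlaw, ae_ne hs hY hlaw hind zero_ne_one] with ω hω hne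
        have hlt := lo_lt_hi (Y · ω) hn hne
        split_ifs with h
        · obtain ⟨p, hp, hep⟩ := exists_lo_eq (Y · ω) (show 1 ≤ n by omega)
          obtain ⟨q, hq, heq⟩ := exists_hi_eq (Y · ω) (show 1 ≤ n by omega)
          have hpq : p ≠ q := by
            rintro rfl
            linarith
          refine le_trans (le_of_eq ?_) (Finset.single_le_sum (f := fun p : ℕ × ℕ =>
            f (Y p.1 ω, Y p.2 ω) * (D p).indicator 1 ω) (fun _ _ => zero_le)
            (Finset.mem_offDiag.2 (⟨Finset.mem_range.2 hp, Finset.mem_range.2 hq, hpq⟩ :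
              (p, q).1 ∈ _ ∧ (p, q).2 ∈ _ ∧ (p, q).1 ≠ (p, q).2)))
          have hmem : ω ∈ D (p, q) := by
            intro r hr
            have hr' : r < n := by simp [F] at hr; exact hr.1
            refine ⟨?_, ?_⟩
            · simp only; rw [← hep]; exact lo_le _ hr'
            · simp only; rw [← heq]; exact le_hi (Y · ω) hr'
          simp only [Set.indicator_of_mem hmem, Pi.one_apply, mul_one, f, oddsKernel]
          rw [← hep, ← heq, if_pos ⟨by rw [hep]; exact (hω p).1, hlt, h⟩]
        · exact zero_le
    _ = ∑ p ∈ I, ∫⁻ ω, f (Y p.1 ω, Y p.2 ω) * (D p).indicator 1 ω ∂P := by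
        refine lintegral_finsetSum _ fun p _ => ?_
        exact ((measurable_oddsKernel _ _ _).comp ((hY _).prodMk (hY _))).mul
          (measurable_one.indicator (hD p))
    _ ≤ ∑ p ∈ I, ENNReal.ofReal (max 0 ((2 * (c - m) + s) / s) ^ n / (2 * n * (1 - k))) := by
        refine Finset.sum_le_sum fun p hp => ?_
        obtain ⟨h1, h2, h3⟩ := Finset.mem_offDiag.1 hp
        refine le_trans (le_of_eq ?_) (lintegral_oddsKernel (m := m) (c := c) hs hk hn)
        rw [lintegral_pair_mul_indicator hs hY hlaw hind h3 (F p) (by simp [F]) (by simp [F])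
          (measurable_oddsKernel _ _ _)]
        have hcard : (F p).card = n - 2 := by
          rw [Finset.card_sdiff_of_subset, Finset.card_range, Finset.card_pair h3]
          intro r hr
          simp only [Finset.mem_insert, Finset.mem_singleton] at hr
          rcases hr with rfl | rfl <;> assumption
        rw [hcard]
    _ ≤ _ := by
        rw [Finset.sum_const, Finset.offDiag_card, Finset.card_range, nsmul_eq_mul,
          ← ENNReal.ofReal_natCast, ← ENNReal.ofReal_mul (by positivity)]
        refine ENNReal.ofReal_le_ofReal ?_
        have h : ((n * n - n : ℕ) : ℝ) ≤ n * n := by exact_mod_cast Nat.sub_le _ _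
        calc _ ≤ (n : ℝ) * n * (max 0 ((2 * (c - m) + s) / s) ^ n / (2 * n * (1 - k))) := by
              gcongr
          _ = _ := by field_simp

end sample

lemma measurable_lo {Ω : Type*} {mΩ : MeasurableSpace Ω} {Y : ℕ → Ω → ℝ}
    (hY : ∀ n, Measurable (Y n)) (n : ℕ) : Measurable fun ω => lo (Y · ω) n := by
  induction n with
  | zero => exact hY 0
  | succ n ih => exact ih.min (hY n)

lemma measurable_hi {Ω : Type*} {mΩ : MeasurableSpace Ω} {Y : ℕ → Ω → ℝ}
    (hY : ∀ n, Measurable (Y n)) (n : ℕ) : Measurable fun ω => hi (Y · ω) n := by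
  induction n with
  | zero => exact hY 0
  | succ n ih => exact ih.max (hY n)

lemma measurable_oddsBound {Ω : Type*} {mΩ : MeasurableSpace Ω} {Y : ℕ → Ω → ℝ}
    (hY : ∀ n, Measurable (Y n)) (k c : ℝ) (n : ℕ) :
    Measurable fun ω => oddsBound k c n (Y · ω) := by
  have h1 := measurable_lo hY n
  have h2 := measurable_hi hY n
  unfold oddsBound
  exact Measurable.ite (measurableSet_le (h1.add h2) measurable_const) (by fun_prop) (by fun_prop)

section sample

variable {Ω : Type*} [MeasurableSpace Ω] {P : Measure Ω} [IsProbabilityMeasure P]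
  {Y : ℕ → Ω → ℝ} {m s : ℝ}

/-- There are three regimes for the midrange. At most `c`, the odds are integrated by
`lintegral_odds_le`. Between `c` and `m - d * s / 2`, the odds are at most one, on an event of
geometrically small probability. Above that, since the range is at most `s`, `2 * (hi - c)` is at
least `1 + d` times the range. -/
lemma lintegral_oddsBound_le (hs : 0 < s) (hY : ∀ n, Measurable (Y n))
    (hlaw : ∀ n, P.map (Y n) = uniLaw m s) (hind : iIndepFun Y P) {n : ℕ} (hn : 2 ≤ n)
    {k : ℝ} (hk : k < 1) (hnk : 0 < n + k - 2) {d : ℝ} (hd : 0 < d) :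
    ∫⁻ ω, ENNReal.ofReal (oddsBound k (m - d * s) n (Y · ω)) ∂P ≤
      ENNReal.ofReal (n * max 0 (1 - 2 * d) ^ n / (1 - k) + max 0 (1 - d) ^ n +
        (1 + d)⁻¹ ^ (n + k - 2)) := by
  have hk' : 0 < 1 - k := by linarith
  set c := m - d * s with hc
  have hds : 0 < d * s := mul_pos hd hs
  let E : Set Ω := {ω | lo (Y · ω) n + hi (Y · ω) n ≤ 2 * (m - d * s / 2)}
  have hmlo := measurable_lo hY n
  have hmhi := measurable_hi hY n
  have hE : MeasurableSet E := measurableSet_le (hmlo.add hmhi) measurable_const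
  let g : Ω → ℝ≥0∞ := fun ω => if lo (Y · ω) n + hi (Y · ω) n ≤ 2 * c then ENNReal.ofReal
        ((2 * (c - lo (Y · ω) n) / (hi (Y · ω) n - lo (Y · ω) n)) ^ (n + k - 2)) else 0
  have hg : Measurable g :=
    Measurable.ite (measurableSet_le (hmlo.add hmhi) measurable_const) (by fun_prop) (by fun_prop)
  calc _ ≤ ∫⁻ ω, (2 * g ω + E.indicator 1 ω) +
        ENNReal.ofReal ((1 + d)⁻¹ ^ (n + k - 2)) ∂P := by
        refine lintegral_mono_ae ?_
        filter_upwards [ae_mem_Icc hY hlaw, ae_ne hs hY hlaw hind zero_ne_one] with ω hω hne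
        have hlt := lo_lt_hi (Y · ω) hn hne
        obtain ⟨p, hp, hep⟩ := exists_lo_eq (Y · ω) (show 1 ≤ n by omega)
        obtain ⟨q, hq, heq⟩ := exists_hi_eq (Y · ω) (show 1 ≤ n by omega)
        have hR : hi (Y · ω) n - lo (Y · ω) n ≤ s := by
          rw [hep, heq]
          linarith [(hω p).1, (hω q).2]
        have hR0 : 0 < hi (Y · ω) n - lo (Y · ω) n := by linarith
        unfold oddsBound
        simp only [g]
        split_ifs with h
        · refine le_trans (le_of_eq ?_) (le_self_add.trans le_self_add)
          rw [ENNReal.ofReal_mul zero_le_two]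
          simp
        · have h2 : 0 < 2 * (hi (Y · ω) n - c) := by linarith
          by_cases hωE : ω ∈ E
          · rw [Set.indicator_of_mem hωE]
            refine le_trans ?_ (le_add_self.trans le_self_add)
            rw [Pi.one_apply, ENNReal.ofReal_le_one]
            refine Real.rpow_le_one (by positivity) ?_ hnk.le
            rw [div_le_one h2]
            linarith
          · refine le_trans (ENNReal.ofReal_le_ofReal ?_) le_add_self
            refine Real.rpow_le_rpow (by positivity) ?_ hnk.le
            have hωE' : 2 * (m - d * s / 2) < lo (Y · ω) n + hi (Y · ω) n := not_le.1 hωE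
            rw [inv_eq_one_div, div_le_div_iff₀ h2 (by linarith)]
            have : (hi (Y · ω) n - lo (Y · ω) n) * d ≤ s * d := by gcongr
            nlinarith
    _ = 2 * ∫⁻ ω, g ω ∂P + P E + ENNReal.ofReal ((1 + d)⁻¹ ^ (n + k - 2)) := by
        rw [lintegral_add_right _ measurable_const, lintegral_const, measure_univ, mul_one,
          lintegral_add_right _ (measurable_one.indicator hE), lintegral_indicator_one hE,
          lintegral_const_mul _ hg]
    _ ≤ 2 * ENNReal.ofReal (n * max 0 ((2 * (c - m) + s) / s) ^ n / (2 * (1 - k))) +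
        ENNReal.ofReal (max 0 (1 - 2 * (d * s / 2) / s) ^ n) +
        ENNReal.ofReal ((1 + d)⁻¹ ^ (n + k - 2)) := by
        gcongr
        · exact lintegral_odds_le hs hY hlaw hind hn hk c
        · exact measure_midrange_le_le hs hY hlaw hind (by omega) _
    _ = _ := by
        rw [show 1 - 2 * (d * s / 2) / s = 1 - d by field_simp,
          show (2 * (c - m) + s) / s = 1 - 2 * d by rw [hc]; field_simp; ring,
          show (2 : ℝ≥0∞) = ENNReal.ofReal 2 by simp, ← ENNReal.ofReal_mul zero_le_two,
          ← ENNReal.ofReal_add (by positivity) (by positivity),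
          ← ENNReal.ofReal_add (by positivity) (by positivity)]
        congr 3
        field_simp

/-! ### Summation over the number of observations -/

lemma sum_pow_max_le {d : ℝ} (hd : 0 < d) (T : ℕ) :
    ∑ n ∈ Finset.range T, max 0 (1 - d) ^ (n + 1) ≤ 1 / d := by
  rcases le_total 1 d with h | h
  · simp only [max_eq_left (sub_nonpos.2 h), ne_eq, Nat.add_eq_zero_iff, one_ne_zero, and_false,
      not_false_eq_true, zero_pow, Finset.sum_const_zero]
    positivity
  · rw [max_eq_right (sub_nonneg.2 h)]
    have hs := (hasSum_geometric_of_lt_one (sub_nonneg.2 h) (by linarith)).mul_left (1 - d)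
    have := sum_le_hasSum (Finset.range T) (fun n _ => by
      have := sub_nonneg.2 h
      positivity) hs
    simp only [← pow_succ'] at this
    refine this.trans ?_
    rw [sub_sub_cancel, ← one_div]
    refine mul_le_of_le_one_left (by positivity) (by linarith)

lemma sum_mul_pow_max_le {d : ℝ} (hd : 0 < d) (T : ℕ) :
    ∑ n ∈ Finset.range T, n * max 0 (1 - d) ^ n ≤ 1 / d ^ 2 := by
  rcases le_total 1 d with h | h
  · rw [max_eq_left (sub_nonpos.2 h)]
    rw [Finset.sum_eq_zero]
    · positivity
    · intro n _
      rcases eq_or_ne n 0 with rfl | hn <;> simp [*]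
  · rw [max_eq_right (sub_nonneg.2 h)]
    have hnn := sub_nonneg.2 h
    have hs := hasSum_coe_mul_geometric_of_norm_lt_one (r := 1 - d)
      (by rw [Real.norm_eq_abs, abs_of_nonneg hnn]; linarith)
    refine (sum_le_hasSum (Finset.range T) (fun n _ => by positivity) hs).trans ?_
    rw [sub_sub_cancel]
    gcongr
    linarith

lemma sum_inv_rpow_le {d x : ℝ} (hd : 0 < d) (hx : 0 ≤ x) (T : ℕ) :
    ∑ n ∈ Finset.range T, (1 + d)⁻¹ ^ (n + x) ≤ 1 + 1 / d := by
  have h1 : (1 + d)⁻¹ < 1 := inv_lt_one_of_one_lt₀ (by linarith)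
  have h0 : 0 < (1 + d)⁻¹ := by positivity
  calc _ ≤ ∑ n ∈ Finset.range T, (1 + d)⁻¹ ^ n := by
        refine Finset.sum_le_sum fun n _ => ?_
        rw [← Real.rpow_natCast]
        exact Real.rpow_le_rpow_of_exponent_ge h0 h1.le (by linarith)
    _ ≤ _ := by
        refine (sum_le_hasSum (Finset.range T) (fun n _ => by positivity)
          (hasSum_geometric_of_lt_one h0.le h1)).trans (le_of_eq ?_)
        rw [show 1 - (1 + d)⁻¹ = d / (1 + d) by field_simp; ring]
        field_simp
        ring

lemma initialPlays_eq {k : ℝ} (hk : k < 1) : (initialPlays k : ℝ) = 3 - ⌈k⌉ := by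
  have h : ⌈k⌉ ≤ 1 := Int.ceil_le.2 (by simpa using hk.le)
  have h2 : (initialPlays k : ℤ) = 3 - ⌈k⌉ := by
    unfold initialPlays
    omega
  exact_mod_cast h2

lemma two_le_initialPlays (k : ℝ) : 2 ≤ initialPlays k := le_max_left _ _

/-- This accounts for the size of `initialPlays`: every posterior sampled from is almost surely
proper. -/
lemma initialPlays_add_pos {k : ℝ} (hk : k < 1) : 0 < initialPlays k + k - 2 := by
  rw [initialPlays_eq hk]
  linarith [Int.ceil_lt_add_one k]

lemma sum_lintegral_oddsBound_le (hs : 0 < s) (hY : ∀ n, Measurable (Y n))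
    (hlaw : ∀ n, P.map (Y n) = uniLaw m s) (hind : iIndepFun Y P)
    {k : ℝ} (hk : k < 1) {d : ℝ} (hd : 0 < d) (T : ℕ) :
    ∑ n ∈ Finset.range T, ∫⁻ ω, (if initialPlays k ≤ n then
        ENNReal.ofReal (oddsBound k (m - d * s) n (Y · ω)) else 0) ∂P ≤
      ENNReal.ofReal (1 + 2 / d + 1 / (4 * d ^ 2 * (1 - k))) := by
  have hk' : 0 < 1 - k := by linarith
  set n₀ := initialPlays k with hn₀
  have h2 : 2 ≤ n₀ := two_le_initialPlays k
  have hpos : 0 < n₀ + k - 2 := initialPlays_add_pos hk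
  have hterm : ∀ n, n₀ ≤ n → 0 < n + k - 2 := by
    intro n hn
    have : (n₀ : ℝ) ≤ n := by exact_mod_cast hn
    linarith
  set A : ℕ → ℝ := fun n => n * max 0 (1 - 2 * d) ^ n / (1 - k)
  set B : ℕ → ℝ := fun n => max 0 (1 - d) ^ n
  set C : ℕ → ℝ := fun n => (1 + d)⁻¹ ^ (n + k - 2)
  have hA : ∀ n, 0 ≤ A n := fun n => by positivity
  have hB : ∀ n, 0 ≤ B n := fun n => by positivity
  have hC : ∀ n, 0 ≤ C n := fun n => by positivity
  calc _ ≤ ∑ n ∈ Finset.range (n₀ + T), ∫⁻ ω, (if n₀ ≤ n then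
        ENNReal.ofReal (oddsBound k (m - d * s) n (Y · ω)) else 0) ∂P :=
        Finset.sum_le_sum_of_subset (Finset.range_subset_range.2 (by omega))
    _ = ∑ i ∈ Finset.range T,
        ∫⁻ ω, ENNReal.ofReal (oddsBound k (m - d * s) (n₀ + i) (Y · ω)) ∂P := by
        rw [Finset.sum_range_add, Finset.sum_eq_zero, zero_add]
        · simp
        · intro n hn
          simp [not_le.2 (Finset.mem_range.1 hn)]
    _ ≤ ∑ i ∈ Finset.range T, ENNReal.ofReal (A (n₀ + i) + B (n₀ + i) + C (n₀ + i)) := by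
        refine Finset.sum_le_sum fun i _ => ?_
        exact lintegral_oddsBound_le hs hY hlaw hind (by omega) hk (hterm _ (by omega)) hd
    _ = ENNReal.ofReal (∑ i ∈ Finset.range T, (A (n₀ + i) + B (n₀ + i) + C (n₀ + i))) := by
        rw [ENNReal.ofReal_sum_of_nonneg]
        intro i _
        have := hA (n₀ + i); have := hB (n₀ + i); have := hC (n₀ + i)
        positivity
    _ ≤ _ := by
        refine ENNReal.ofReal_le_ofReal ?_
        rw [Finset.sum_add_distrib, Finset.sum_add_distrib]
        have h1 : ∑ i ∈ Finset.range T, A (n₀ + i) ≤ 1 / (4 * d ^ 2 * (1 - k)) := by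
          have := sum_mul_pow_max_le (d := 2 * d) (by linarith) (n₀ + T)
          rw [Finset.sum_range_add] at this
          have h0 : 0 ≤ ∑ n ∈ Finset.range n₀, (n : ℝ) * max 0 (1 - 2 * d) ^ n :=
            Finset.sum_nonneg fun n _ => by positivity
          simp only [A]
          rw [← Finset.sum_div, div_le_iff₀ hk']
          calc _ ≤ 1 / (2 * d) ^ 2 := by linarith
            _ = _ := by field_simp; norm_num
        have h2 : ∑ i ∈ Finset.range T, B (n₀ + i) ≤ 1 / d := by
          have := sum_pow_max_le hd ((n₀ - 1) + T)
          rw [Finset.sum_range_add] at this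
          have h0 : 0 ≤ ∑ n ∈ Finset.range (n₀ - 1), max 0 (1 - d) ^ (n + 1) :=
            Finset.sum_nonneg fun n _ => by positivity
          calc _ = ∑ i ∈ Finset.range T, max 0 (1 - d) ^ (n₀ - 1 + i + 1) := by
                refine Finset.sum_congr rfl fun i _ => ?_
                rw [show n₀ - 1 + i + 1 = n₀ + i by omega]
            _ ≤ _ := by linarith
        have h3 : ∑ i ∈ Finset.range T, C (n₀ + i) ≤ 1 + 1 / d := by
          refine le_trans (le_of_eq ?_) (sum_inv_rpow_le hd hpos.le T)
          refine Finset.sum_congr rfl fun i _ => ?_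
          simp only [C]
          congr 1
          push_cast
          ring
        calc _ ≤ 1 / (4 * d ^ 2 * (1 - k)) + 1 / d + (1 + 1 / d) := by gcongr
          _ = _ := by ring

end sample

/-! ### The constant `constC` -/

/-- The left side is the bound of `sum_lintegral_oddsBound_le` at `d = 3 / 2 * ε / s`. The slack is
`4 / 3 ≤ 9`, `1 / 9 ≤ 3 / 16` and an exponential factor at least one. -/
lemma constC_bound {ε k s : ℝ} (hε : 0 < ε) (hs : 0 < s) (hk : k < 1) :
    1 + 2 / (3 / 2 * ε / s) + 1 / (4 * (3 / 2 * ε / s) ^ 2 * (1 - k)) ≤ constC ε k s := by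
  have hk' : 0 < 1 - k := by linarith
  have h1 : 2 / (3 / 2 * ε / s) ≤ 9 * s / ε := by
    rw [div_le_div_iff₀ (by positivity) hε]
    field_simp
    norm_num
  have h2 : 1 / (4 * (3 / 2 * ε / s) ^ 2 * (1 - k)) =
      1 / (9 * (1 - k)) * (s ^ 2 / ε ^ 2) * 1 := by
    field_simp
    norm_num
  have h3 : 1 ≤ 2 * Real.exp (2 * ε / s) - 1 := by
    have := Real.one_le_exp (show 0 ≤ 2 * ε / s by positivity)
    linarith
  have h4 : 1 / (9 * (1 - k)) ≤ 3 / (16 * (1 - k)) := by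
    rw [div_le_div_iff₀ (by positivity) (by positivity)]
    nlinarith
  unfold constC
  rw [h2]
  gcongr

/-- Divided by the claimed order, `constC` is increasing in `1 - k` and in `ε / s`; the witness is
the value of the quotient at `k₀` and `R`. -/
lemma constC_isBigO (k₀ R : ℝ) : ∃ M : ℝ, ∀ k : ℝ, k₀ ≤ k → k < 1 → ∀ s : ℝ, 0 < s →
    ∀ ε : ℝ, 0 < ε → ε ≤ R * s → |constC ε k s| ≤ M * (s ^ 2 / ((1 - k) * ε ^ 2)) := by
  refine ⟨(1 - k₀) * R ^ 2 + 9 * (1 - k₀) * R + 3 / 16 * (2 * Real.exp (2 * R) - 1), ?_⟩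
  intro k hk₀ hk s hs ε hε hεR
  have hk' : 0 < 1 - k := by linarith
  have hr : ε / s ≤ R := by rwa [div_le_iff₀ hs]
  have hr0 : 0 < ε / s := by positivity
  have hR : 0 < R := hr0.trans_le hr
  have hexp : Real.exp (2 * ε / s) ≤ Real.exp (2 * R) := by
    rw [mul_div_assoc]
    gcongr
  have hexp1 := Real.one_le_exp (show 0 ≤ 2 * ε / s by positivity)
  have hkk : 1 - k ≤ 1 - k₀ := by linarith
  have heq : constC ε k s = ((1 - k) * (ε / s) ^ 2 + 9 * (1 - k) * (ε / s) +
      3 / 16 * (2 * Real.exp (2 * ε / s) - 1)) * (s ^ 2 / ((1 - k) * ε ^ 2)) := by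
    unfold constC
    field_simp
  have hpos : 0 ≤ constC ε k s := by
    unfold constC
    have : 0 ≤ 2 * Real.exp (2 * ε / s) - 1 := by linarith
    positivity
  rw [abs_of_nonneg hpos, heq]
  gcongr
  all_goals linarith

/-! ### Kullback-Leibler divergences of uniform laws -/

lemma uniLaw_Ioo_pos {m s a b : ℝ} (hs : 0 < s) (hab : a < b) (ha : m - s / 2 ≤ a)
    (hb : b ≤ m + s / 2) : 0 < uniLaw m s (Set.Ioo a b) := by
  rw [uniLaw_eq, Measure.smul_apply, Measure.restrict_apply measurableSet_Ioo, smul_eq_mul,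
    Set.inter_eq_left.2 (Set.Ioo_subset_Icc_self.trans (Set.Icc_subset_Icc ha hb)),
    Real.volume_Ioo]
  have : 0 < b - a := by linarith
  exact ENNReal.mul_pos (by simpa using hs) (by simpa using hab)

/-- A part of the first support sticking out of the second would contain an interval of positive
mass that is null for the second law. -/
lemma endpoints_le_of_absolutelyContinuous {m s m' s' : ℝ} (hs : 0 < s)
    (h : uniLaw m s ≪ uniLaw m' s') :
    m' - s' / 2 ≤ m - s / 2 ∧ m + s / 2 ≤ m' + s' / 2 := by
  have hae := h.ae_le (uniLaw_ae_mem m' s')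
  have hnull : ∀ a b, m - s / 2 ≤ a → b ≤ m + s / 2 →
      (∀ x ∈ Set.Ioo a b, x ∉ Set.Icc (m' - s' / 2) (m' + s' / 2)) → b ≤ a := by
    intro a b ha hb hdis
    by_contra! hab
    exact (uniLaw_Ioo_pos hs hab ha hb).ne' (measure_mono_null hdis hae)
  constructor
  · by_contra! hlt
    -- The `min` keeps the interval inside the first support even if the supports are disjoint.
    have := hnull (m - s / 2) (min (m' - s' / 2) (m + s / 2)) le_rfl (min_le_right _ _)
      fun x hx hx' => (hx.2.trans_le (min_le_left _ _)).not_ge hx'.1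
    rcases min_le_iff.1 this with h | h <;> linarith
  · by_contra! hlt
    have := hnull (max (m' + s' / 2) (m - s / 2)) (m + s / 2) (le_max_right _ _) le_rfl
      fun x hx hx' => ((le_max_left _ _).trans_lt hx.1).not_ge hx'.2
    rcases le_max_iff.1 this with h | h <;> linarith

lemma klDiv_uniLaw {m s m' s' : ℝ} (hs : 0 < s) (hs' : 0 < s') (hl : m' - s' / 2 ≤ m - s / 2)
    (hr : m + s / 2 ≤ m' + s' / 2) : InformationTheory.klDiv (uniLaw m s) (uniLaw m' s') =
      ENNReal.ofReal (Real.log (s' / s)) := by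
  have := isProbabilityMeasure_uniLaw m hs
  have := isProbabilityMeasure_uniLaw m' hs'
  set f : ℝ → ℝ≥0∞ := (Set.Icc (m - s / 2) (m + s / 2)).indicator
    fun _ => ENNReal.ofReal (s' / s) with hf_def
  have hf : Measurable f := measurable_const.indicator measurableSet_Icc
  have hμ : uniLaw m s = (uniLaw m' s').withDensity f := by
    rw [hf_def, withDensity_indicator measurableSet_Icc, withDensity_const, uniLaw_eq, uniLaw_eq,
      Measure.restrict_smul, Measure.restrict_restrict measurableSet_Icc, smul_smul,
      Set.inter_eq_left.2 (Set.Icc_subset_Icc hl hr), ← ENNReal.ofReal_mul (by positivity)]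
    congr 2
    field_simp
  have hac : uniLaw m s ≪ uniLaw m' s' := by
    rw [hμ]
    exact withDensity_absolutelyContinuous _ _
  have hllr : llr (uniLaw m s) (uniLaw m' s') =ᵐ[uniLaw m s] fun _ => Real.log (s' / s) := by
    have hrn : (uniLaw m s).rnDeriv (uniLaw m' s') =ᵐ[uniLaw m' s'] f := by
      nth_rw 1 [hμ]
      exact Measure.rnDeriv_withDensity _ hf
    filter_upwards [hac.ae_le hrn, uniLaw_ae_mem m s] with x hx hx'
    rw [llr, hx, hf_def, Set.indicator_of_mem hx', ENNReal.toReal_ofReal (by positivity)]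
  rw [InformationTheory.klDiv_of_ac_of_integrable hac
    ((integrable_congr hllr).2 (integrable_const _)), integral_congr_ae hllr]
  simp

/-- A support centred at `m > μ a` and covering that of arm `i` has length at least `σ i + 2 * (m -
μ i)`. The constraint on `m` is strict, so the infimum is only approached, with `m = μ a + η` and `η
→ 0`. -/
lemma klInf_eq {K : ℕ} {μ σ : Fin K → ℝ} (hσ : ∀ i, 0 < σ i) {a i : Fin K} (hi : μ i < μ a) :
    klInf μ σ a i = ENNReal.ofReal (Real.log (1 + 2 * gap μ a i / σ i)) := by
  have hs := hσ i
  have hgap : 0 < gap μ a i := sub_pos.2 hi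
  refine le_antisymm ?_ ?_
  · have hle : ∀ η : ℝ, 0 < η →
        klInf μ σ a i ≤ ENNReal.ofReal (Real.log (1 + 2 * (gap μ a i + η) / σ i)) := by
      intro η hη
      have hs' : 0 < σ i + 2 * (gap μ a i + η) := by linarith
      refine (iInf₂_le (μ a + η) (σ i + 2 * (gap μ a i + η))).trans ?_
      refine (iInf₂_le hs' (by linarith)).trans (le_of_eq ?_)
      rw [klDiv_uniLaw hs hs' (by unfold gap; linarith) (by unfold gap; linarith)]
      congr 2
      field_simp
    have hcont : ContinuousAt
        (fun η : ℝ => ENNReal.ofReal (Real.log (1 + 2 * (gap μ a i + η) / σ i))) 0 := by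
      refine ENNReal.continuous_ofReal.continuousAt.comp (ContinuousAt.log (by fun_prop) ?_)
      have : 0 < 1 + 2 * (gap μ a i + 0) / σ i := by rw [add_zero]; positivity
      exact this.ne'
    have htend := hcont.tendsto.mono_left (nhdsWithin_le_nhds (s := Set.Ioi 0))
    rw [add_zero] at htend
    exact ge_of_tendsto htend (eventually_mem_nhdsWithin.mono fun η hη => hle η hη)
  · refine le_iInf fun m => le_iInf fun s => le_iInf fun hs' => le_iInf fun hm => ?_
    by_cases hac : uniLaw (μ i) (σ i) ≪ uniLaw m s
    · obtain ⟨hl, hr⟩ := endpoints_le_of_absolutelyContinuous hs hac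
      rw [klDiv_uniLaw hs hs' hl hr]
      refine ENNReal.ofReal_le_ofReal (Real.log_le_log (by positivity) ?_)
      rw [le_div_iff₀ hs]
      field_simp
      unfold gap
      linarith
    · rw [InformationTheory.klDiv_of_not_ac hac]
      exact le_top

/-! ### From rounds to numbers of plays -/

section pulls

variable {Ω : Type*} {K : ℕ} (j : ℕ → Ω → Fin K) (i : Fin K)

lemma pulls_succ (t : ℕ) (ω : Ω) :
    pulls j i (t + 1) ω = pulls j i t ω + if j t ω = i then 1 else 0 := by
  unfold pulls
  rw [Finset.range_add_one, Finset.filter_insert]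
  split_ifs with h
  · rw [Finset.card_insert_of_notMem (by simp)]
  · rfl

lemma pulls_mono (ω : Ω) : Monotone fun t => pulls j i t ω :=
  monotone_nat_of_le_succ fun t => by rw [pulls_succ]; exact Nat.le_add_right _ _

lemma pulls_le (t : ℕ) (ω : Ω) : pulls j i t ω ≤ t := by
  exact (Finset.card_filter_le _ _).trans_eq (Finset.card_range t)

/-- Along the rounds that play `i`, the counter takes each value below its final one exactly once.
-/
lemma sum_pulls {M : Type*} [AddCommMonoid M] (f : ℕ → M) (T : ℕ) (ω : Ω) :
    ∑ t ∈ Finset.range T, (if j t ω = i then f (pulls j i t ω) else 0) =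
      ∑ n ∈ Finset.range (pulls j i T ω), f n := by
  induction T with
  | zero => simp [pulls]
  | succ T ih =>
    rw [Finset.sum_range_succ, ih, pulls_succ]
    split_ifs <;> simp [Finset.sum_range_succ]

lemma measurable_pulls {m : MeasurableSpace Ω} {t : ℕ} (hj : ∀ s < t, Measurable (j s)) :
    Measurable (pulls j i t) := by
  have h : pulls j i t = fun ω => ∑ s ∈ Finset.range t, if j s ω = i then 1 else 0 := by
    ext ω
    exact Finset.card_filter _ _
  rw [h]
  refine Finset.measurable_sum _ fun s hs => ?_
  exact Measurable.ite (hj s (Finset.mem_range.1 hs) (measurableSet_singleton i))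
    measurable_const measurable_const

lemma measurable_comp_pulls {β : Type*} [MeasurableSpace β] {m : MeasurableSpace Ω} {t : ℕ}
    (hj : ∀ s < t, Measurable (j s)) {f : ℕ → Ω → β} (hf : ∀ n, Measurable (f n)) :
    Measurable fun ω => f (pulls j i t ω) ω :=
  (measurable_from_prod_countable_right (f := fun p : ℕ × Ω => f p.1 p.2) hf).comp
    ((measurable_pulls j i hj).prodMk measurable_id)

variable {j}

lemma sum_lintegral_pulls_le [MeasurableSpace Ω] (P : Measure Ω) (hj : ∀ t, Measurable (j t))
    {f : ℕ → Ω → ℝ≥0∞} (hf : ∀ n, Measurable (f n)) (T : ℕ) :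
    ∑ t ∈ Finset.range T, ∫⁻ ω, (if j t ω = i then f (pulls j i t ω) ω else 0) ∂P ≤
      ∑ n ∈ Finset.range T, ∫⁻ ω, f n ω ∂P := by
  rw [← lintegral_finsetSum, ← lintegral_finsetSum _ fun n _ => hf n]
  · refine lintegral_mono fun ω => ?_
    rw [sum_pulls j i (fun n => f n ω)]
    exact Finset.sum_le_sum_of_subset (Finset.range_subset_range.2 (pulls_le j i T ω))
  · intro t _
    exact Measurable.ite (hj t (measurableSet_singleton i))
      (measurable_comp_pulls j i (fun s _ => hj s) hf) measurable_const

lemma sum_measure_pulls_le [MeasurableSpace Ω] (P : Measure Ω) (hj : ∀ t, Measurable (j t))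
    {S : ℕ → Set Ω} (hS : ∀ n, MeasurableSet (S n)) (T : ℕ) :
    ∑ t ∈ Finset.range T, P {ω | j t ω = i ∧ ω ∈ S (pulls j i t ω)} ≤
      ∑ n ∈ Finset.range T, P (S n) := by
  have h := sum_lintegral_pulls_le i P hj (f := fun n => (S n).indicator 1)
    (fun n => measurable_one.indicator (hS n)) T
  simp only [lintegral_indicator_one (hS _)] at h
  refine le_trans (Finset.sum_le_sum fun t _ => ?_) h
  have hmeas : MeasurableSet {ω | j t ω = i ∧ ω ∈ S (pulls j i t ω)} := by
    have hm := measurable_comp_pulls j i (t := t) (fun s _ => hj s)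
      (f := fun n ω => (S n).indicator (1 : Ω → ℝ≥0∞) ω)
      (fun n => measurable_one.indicator (hS n))
    have he : {ω | ω ∈ S (pulls j i t ω)} =
        (fun ω => (S (pulls j i t ω)).indicator (1 : Ω → ℝ≥0∞) ω) ⁻¹' {1} := by
      ext ω
      simp [Set.indicator]
    have hm' : MeasurableSet {ω | ω ∈ S (pulls j i t ω)} := he ▸ hm (measurableSet_singleton 1)
    exact (hj t (measurableSet_singleton i)).inter hm'
  rw [← lintegral_indicator_one hmeas]
  refine lintegral_mono fun ω => ?_
  simp only [Set.indicator, Set.mem_ofPred_eq, Pi.one_apply]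
  split_ifs <;> simp_all

end pulls

/-! ### Conditioning on the past -/

/-- No integrability of `w` is needed: both sides integrate `w` against measures that agree on `m`,
by the defining property of conditional expectation. -/
lemma lintegral_mul_condProb {Ω : Type*} {m m0 : MeasurableSpace Ω} (hm : m ≤ m0)
    (P : Measure[m0] Ω) [IsProbabilityMeasure P] {G : Set Ω} (hG : MeasurableSet[m0] G)
    {w : Ω → ℝ≥0∞} (hw : Measurable[m] w) :
    ∫⁻ ω, w ω * ENNReal.ofReal ((P⟦G | m⟧) ω) ∂P = ∫⁻ ω in G, w ω ∂P := by
  have hint : Integrable (G.indicator fun _ => (1 : ℝ)) P :=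
    (integrable_const 1).indicator hG
  have hnn : 0 ≤ᵐ[P] P⟦G | m⟧ :=
    condExp_nonneg (ae_of_all _ fun ω => Set.indicator_nonneg (fun _ _ => zero_le_one) ω)
  have hcm : Measurable[m] fun ω => ENNReal.ofReal ((P⟦G | m⟧) ω) :=
    ENNReal.measurable_ofReal.comp stronglyMeasurable_condExp.measurable
  have hmeas : (P.trim hm).withDensity (fun ω => ENNReal.ofReal ((P⟦G | m⟧) ω)) =
      (P.restrict G).trim hm := by
    refine @Measure.ext Ω m _ _ fun A hA => ?_
    rw [withDensity_apply _ hA, setLIntegral_trim hm hcm hA, trim_measurableSet_eq hm hA,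
      Measure.restrict_apply (hm _ hA), ← ofReal_integral_eq_lintegral_ofReal
        integrable_condExp.integrableOn (ae_restrict_of_ae hnn), setIntegral_condExp hm hint hA,
      setIntegral_indicator hG]
    simp [measureReal_def]
  have h1 : ∫⁻ ω, w ω * ENNReal.ofReal ((P⟦G | m⟧) ω) ∂P =
      ∫⁻ ω, w ω * ENNReal.ofReal ((P⟦G | m⟧) ω) ∂(P.trim hm) := (lintegral_trim hm
        (hw.mul hcm)).symm
  rw [h1, ← lintegral_trim hm hw, ← hmeas, lintegral_withDensity_eq_lintegral_mul _ hcm hw]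
  simp only [Pi.mul_apply, mul_comm]

section past

variable {Ω : Type*} {K : ℕ} {X : Fin K → ℕ → Ω → ℝ} {θ : ℕ → Fin K → Ω → ℝ × ℝ}
  {j : ℕ → Ω → Fin K}

lemma measurable_reward_past (i : Fin K) (n t : ℕ) : Measurable[past X θ j t] (X i n) :=
  Measurable.mono (comap_measurable _)
    (le_sup_of_le_left (le_iSup₂_of_le i n le_rfl)) le_rfl

lemma measurable_arm_past {s t : ℕ} (hst : s < t) : Measurable[past X θ j t] (j s) :=
  Measurable.mono (comap_measurable _)
    (le_sup_of_le_right (le_iSup₂_of_le s hst le_sup_right)) le_rfl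

end past

/-! ### The sampling rule and rounds with low samples -/

section sampling

variable {Ω : Type*} [MeasurableSpace Ω] {P : Measure Ω} {K : ℕ}
  {μ σ : Fin K → ℝ} {k : ℝ} {X : Fin K → ℕ → Ω → ℝ} {θ : ℕ → Fin K → Ω → ℝ × ℝ}
  {j : ℕ → Ω → Fin K}

namespace IsThompsonSampling

lemma past_le (h : IsThompsonSampling P μ σ k X θ j) (t : ℕ) :
    past X θ j t ≤ (inferInstance : MeasurableSpace Ω) := by
  refine sup_le (iSup₂_le fun i n => (h.measurable_reward i n).comap_le)
    (iSup₂_le fun s _ => sup_le (iSup_le fun i => (h.measurable_sample s i).comap_le)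
      (h.measurable_arm s).comap_le)

lemma initialPlays_le_pulls (h : IsThompsonSampling P μ σ k X θ j) {t : ℕ}
    (ht : K * initialPlays k ≤ t) (i : Fin K) (ω : Ω) : initialPlays k ≤ pulls j i t ω :=
  (h.initial i ω).ge.trans (pulls_mono j i ω ht)

lemma pulls_lt_initialPlays (h : IsThompsonSampling P μ σ k X θ j) {t : ℕ}
    (ht : t < K * initialPlays k) {i : Fin K} {ω : Ω} (hi : j t ω = i) :
    pulls j i t ω < initialPlays k := by
  have h1 := pulls_mono j i ω (Nat.succ_le_of_lt ht)
  simp only [h.initial i ω, Nat.succ_eq_add_one, pulls_succ, if_pos hi] at h1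
  omega

lemma iIndepFun_reward (h : IsThompsonSampling P μ σ k X θ j) (i : Fin K) :
    iIndepFun (X i) P :=
  h.reward_indep.precomp (g := fun n => (i, n)) fun _ _ hab => (Prod.mk.inj hab).2

lemma measurableSet_samples (h : IsThompsonSampling P μ σ k X θ j) (t : ℕ)
    {B : Fin K → Set (ℝ × ℝ)} (hB : ∀ i, MeasurableSet (B i)) :
    MeasurableSet {ω | ∀ i, θ t i ω ∈ B i} := by
  have : {ω | ∀ i, θ t i ω ∈ B i} = ⋂ i, θ t i ⁻¹' B i := by ext; simp
  rw [this]
  exact MeasurableSet.iInter fun i => h.measurable_sample t i (hB i)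

variable [IsProbabilityMeasure P]

lemma ae_lo_lt_hi (h : IsThompsonSampling P μ σ k X θ j) (hσ : ∀ i, 0 < σ i) (i : Fin K) :
    ∀ᵐ ω ∂P, ∀ n, 2 ≤ n → lo (X i · ω) n < hi (X i · ω) n := by
  filter_upwards [ae_ne (hσ i) (h.measurable_reward i) (h.reward_law i) (h.iIndepFun_reward i)
    zero_ne_one] with ω hω n hn using lo_lt_hi (X i · ω) hn hω

lemma measure_inter_lt_sample_le (h : IsThompsonSampling P μ σ k X θ j) {t : ℕ}
    (ht : K * initialPlays k ≤ t) (i : Fin K) {E : Set Ω} (hE : MeasurableSet[past X θ j t] E)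
    {c q : ℝ} (hq : ∀ᵐ ω ∂P, ω ∈ E →
      (posterior k (pulls j i t ω) (X i · ω)).real (Prod.fst ⁻¹' Set.Ioi c) ≤ q) :
    P (E ∩ {ω | c < (θ t i ω).1}) ≤ ENNReal.ofReal q := by
  let B : Fin K → Set (ℝ × ℝ) := Function.update (fun _ => Set.univ) i (Prod.fst ⁻¹' Set.Ioi c)
  have hB : ∀ i, MeasurableSet (B i) := by
    intro i'
    rcases eq_or_ne i' i with rfl | hne
    · simpa [B] using measurable_fst measurableSet_Ioi
    · simp [B, hne]
  have hG : {ω | c < (θ t i ω).1} = {ω | ∀ i, θ t i ω ∈ B i} := by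
    ext ω
    simp only [Set.mem_ofPred_eq]
    refine ⟨fun hc i' => ?_, fun hall => by simpa [B] using hall i⟩
    rcases eq_or_ne i' i with rfl | hne
    · simpa [B] using hc
    · simp [B, hne]
  have hle := h.past_le t
  have hw : Measurable[past X θ j t] (E.indicator (1 : Ω → ℝ≥0∞)) :=
    Measurable.indicator (@measurable_const _ _ _ (past X θ j t) 1) hE
  have key := lintegral_mul_condProb hle P (h.measurableSet_samples t hB) hw
  have hint : ∫⁻ ω in {ω | ∀ i, θ t i ω ∈ B i}, E.indicator (1 : Ω → ℝ≥0∞) ω ∂P =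
      P (E ∩ {ω | c < (θ t i ω).1}) := by
    rw [lintegral_indicator_one (hle _ hE), Measure.restrict_apply (hle _ hE), hG]
  rw [← hint, ← key]
  calc _ ≤ ∫⁻ _, ENNReal.ofReal q ∂P := by
        refine lintegral_mono_ae ?_
        filter_upwards [h.sample_law t ht B hB, hq] with ω hω hqω
        by_cases hmem : ω ∈ E
        · rw [Set.indicator_of_mem hmem, Pi.one_apply, one_mul, hω]
          refine ENNReal.ofReal_le_ofReal (le_trans ?_ (hqω hmem))
          rw [← Finset.mul_prod_erase _ _ (Finset.mem_univ i)]
          simp only [B, Function.update_self]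
          refine mul_le_of_le_one_right measureReal_nonneg (Finset.prod_le_one
            (fun _ _ => measureReal_nonneg) fun _ _ => posterior_real_le_one _)
        · rw [Set.indicator_of_notMem hmem, zero_mul]
          exact zero_le
    _ = _ := by simp

/-- In the product of `sample_law`, moving arm `a` from below `c` to above it changes a single
factor, at the cost of the posterior odds. After the move only arm `a` exceeds `c`, so `play_max`
selects it. -/
lemma measure_forall_sample_le (h : IsThompsonSampling P μ σ k X θ j) (hσ : ∀ i, 0 < σ i)
    (hk : k < 1) {t : ℕ} (ht : K * initialPlays k ≤ t) (a : Fin K) (c : ℝ) :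
    P {ω | ∀ i, (θ t i ω).1 ≤ c} ≤ ∫⁻ ω, (if j t ω = a then
      ENNReal.ofReal (oddsBound k c (pulls j a t ω) (X a · ω)) else 0) ∂P := by
  let B : Fin K → Set (ℝ × ℝ) := fun _ => Prod.fst ⁻¹' Set.Iic c
  let B' : Fin K → Set (ℝ × ℝ) := Function.update B a (Prod.fst ⁻¹' Set.Ioi c)
  have hB : ∀ i, MeasurableSet (B i) := fun _ => measurable_fst measurableSet_Iic
  have hB' : ∀ i, MeasurableSet (B' i) := by
    intro i
    rcases eq_or_ne i a with rfl | hne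
    · simpa [B'] using measurable_fst measurableSet_Ioi
    · simpa [B', hne] using hB i
  have hle := h.past_le t
  let w : Ω → ℝ≥0∞ := fun ω => ENNReal.ofReal (oddsBound k c (pulls j a t ω) (X a · ω))
  -- The past includes every reward of arm `a` and the arms played before `t`, so the odds at the
  -- random count are known.
  have hw : Measurable[past X θ j t] w := by
    refine @measurable_comp_pulls Ω K j a _ _ (past X θ j t) t
      (fun s hs => measurable_arm_past hs)
      (fun n ω => ENNReal.ofReal (oddsBound k c n (X a · ω))) fun n => ?_
    exact ENNReal.measurable_ofReal.comp
      (measurable_oddsBound (fun n => measurable_reward_past a n t) k c n)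
  have hG := h.measurableSet_samples t hB
  have hG' := h.measurableSet_samples t hB'
  have key := lintegral_mul_condProb hle P hG (@measurable_const _ _ _ (past X θ j t) (1 : ℝ≥0∞))
  simp only [one_mul, lintegral_one, Measure.restrict_apply_univ] at key
  have key' := lintegral_mul_condProb hle P hG' hw
  calc _ = ∫⁻ ω, ENNReal.ofReal ((P⟦{ω | ∀ i, θ t i ω ∈ B i} | past X θ j t⟧) ω) ∂P := key.symm
    _ ≤ ∫⁻ ω, w ω * ENNReal.ofReal ((P⟦{ω | ∀ i, θ t i ω ∈ B' i} | past X θ j t⟧) ω) ∂P := by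
        refine lintegral_mono_ae ?_
        filter_upwards [h.sample_law t ht B hB, h.sample_law t ht B' hB',
          h.ae_lo_lt_hi hσ a] with ω hω hω' hlt
        have hn := h.initialPlays_le_pulls ht a ω
        have hn2 : 2 ≤ pulls j a t ω := (two_le_initialPlays k).trans hn
        have hnk : 0 < pulls j a t ω + k - 2 := by
          have := initialPlays_add_pos hk
          have : (initialPlays k : ℝ) ≤ pulls j a t ω := by exact_mod_cast hn
          linarith
        have hodds := posterior_real_Iic_le (k := k) (by omega) hnk (hlt _ hn2) c
        rw [hω, hω', ← ENNReal.ofReal_mul (oddsBound_nonneg (hlt _ hn2) c)]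
        refine ENNReal.ofReal_le_ofReal ?_
        rw [← Finset.mul_prod_erase _ _ (Finset.mem_univ a),
          ← Finset.mul_prod_erase _ _ (Finset.mem_univ a), ← mul_assoc]
        have hprod : ∏ i ∈ Finset.univ.erase a,
            (posterior k (pulls j i t ω) (X i · ω)).real (B' i) = ∏ i ∈ Finset.univ.erase a,
            (posterior k (pulls j i t ω) (X i · ω)).real (B i) := by
          refine Finset.prod_congr rfl fun i hi => ?_
          simp [B', Finset.ne_of_mem_erase hi]
        rw [hprod]
        simp only [B', Function.update_self]
        exact mul_le_mul_of_nonneg_right hodds (Finset.prod_nonneg fun _ _ => measureReal_nonneg)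
    _ = ∫⁻ ω in {ω | ∀ i, θ t i ω ∈ B' i}, w ω ∂P := key'
    _ ≤ _ := by
        rw [← lintegral_indicator hG']
        refine lintegral_mono fun ω => ?_
        by_cases hmem : ω ∈ {ω | ∀ i, θ t i ω ∈ B' i}
        · rw [Set.indicator_of_mem hmem, if_pos]
          by_contra hne
          have h1 : c < (θ t a ω).1 := by simpa [B'] using hmem a
          have h2 : (θ t (j t ω) ω).1 ≤ c := by simpa [B', B, hne] using hmem (j t ω)
          exact absurd (h1.trans_le (h.play_max t ht ω a)) (not_lt.2 h2)
        · rw [Set.indicator_of_notMem hmem]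
          exact zero_le

/-- The expected number of rounds after the initial ones in which all sampled locations lie below
that of arm `a` by at least `d * σ a` is bounded. -/
lemma sum_measure_forall_sample_le (h : IsThompsonSampling P μ σ k X θ j) (hσ : ∀ i, 0 < σ i)
    (hk : k < 1) (a : Fin K) {d : ℝ} (hd : 0 < d) (T : ℕ) :
    ∑ t ∈ Finset.range T,
      P {ω | K * initialPlays k ≤ t ∧ ∀ i, (θ t i ω).1 ≤ μ a - d * σ a} ≤
      ENNReal.ofReal (1 + 2 / d + 1 / (4 * d ^ 2 * (1 - k))) := by
  set c := μ a - d * σ a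
  let f : ℕ → Ω → ℝ≥0∞ := fun n ω => if initialPlays k ≤ n then
    ENNReal.ofReal (oddsBound k c n (X a · ω)) else 0
  have hf : ∀ n, Measurable (f n) := fun n => by
    by_cases hn : initialPlays k ≤ n
    · simp only [f, hn, if_true]
      exact ENNReal.measurable_ofReal.comp (measurable_oddsBound (h.measurable_reward a) k c n)
    · simp only [f, hn, if_false]
      exact measurable_const
  calc _ ≤ ∑ t ∈ Finset.range T, ∫⁻ ω, (if j t ω = a then f (pulls j a t ω) ω else 0) ∂P := by
        refine Finset.sum_le_sum fun t _ => ?_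
        by_cases ht : K * initialPlays k ≤ t
        · simp only [ht, true_and, f, h.initialPlays_le_pulls ht a, if_true]
          exact h.measure_forall_sample_le hσ hk ht a c
        · simp [ht]
    _ ≤ ∑ n ∈ Finset.range T, ∫⁻ ω, f n ω ∂P :=
        sum_lintegral_pulls_le a P h.measurable_arm hf T
    _ ≤ _ := sum_lintegral_oddsBound_le (hσ a) (h.measurable_reward a) (h.reward_law a)
        (h.iIndepFun_reward a) hk hd T

end IsThompsonSampling

/-! ### Plays of a suboptimal arm -/

/-- With `R` the range, the ratio in the tail formula is at most `R / (R + y)`, hence at most `s /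
(s + y)`; `hN` makes the exponent at least the logarithm of `T` to base `1 + y / s`. -/
lemma posterior_real_Ioi_le {k : ℝ} {n : ℕ} {x : ℕ → ℝ} {s c y T : ℝ} (hs : 0 < s) (hy : 0 < y)
    (hn : 1 ≤ n) (hk : 0 < n + k - 2) (hT : 0 < T)
    (hx : lo x n < hi x n) (hR : hi x n - lo x n ≤ s) (hc : lo x n + hi x n + y ≤ 2 * c)
    (hN : 2 - k + Real.log T / Real.log (1 + y / s) ≤ n) :
    (posterior k n x).real (Prod.fst ⁻¹' Set.Ioi c) ≤ 1 / (2 * T) := by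
  rw [posterior_real_Ioi hn hk hx (by linarith)]
  have hR0 : 0 < hi x n - lo x n := by linarith
  have hys : 0 < y / s := by positivity
  have hρ : 1 < 1 + y / s := by linarith
  have h1 : (hi x n - lo x n) / (2 * (c - lo x n)) ≤ (1 + y / s)⁻¹ := by
    have : (1 + y / s)⁻¹ = s / (s + y) := by field_simp
    rw [this, div_le_div_iff₀ (by linarith) (by linarith)]
    nlinarith
  have h2 : T ≤ (1 + y / s) ^ (n + k - 2) := by
    calc T = (1 + y / s) ^ (Real.log T / Real.log (1 + y / s)) := by
          rw [Real.log_div_log, Real.rpow_logb (by linarith) hρ.ne' hT]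
      _ ≤ _ := Real.rpow_le_rpow_of_exponent_le hρ.le (by linarith)
  calc _ ≤ 1 / 2 * (1 + y / s)⁻¹ ^ (n + k - 2) := by
        gcongr
        exact div_nonneg hR0.le (by linarith)
    _ ≤ 1 / 2 * T⁻¹ := by
        rw [Real.inv_rpow (by linarith)]
        gcongr
    _ = _ := by field_simp

namespace IsThompsonSampling

variable [IsProbabilityMeasure P]

/-- A bound for the expected number of plays of arm `i` in the rounds in which not all sampled
locations are at most `c`. -/
lemma sum_measure_arm_le (h : IsThompsonSampling P μ σ k X θ j) (hσ : ∀ i, 0 < σ i) (hk : k < 1)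
    {a i : Fin K} {ε : ℝ} (hε : 0 < ε) (hgap : ε < gap μ a i / 2) {T : ℕ} (hT : 1 ≤ T) :
    ∑ t ∈ Finset.range T, P {ω | j t ω = i} ≤
      ∑ t ∈ Finset.range T, P {ω | j t ω = i ∧ K * initialPlays k ≤ t ∧
        ∀ i', (θ t i' ω).1 ≤ μ a - 3 / 2 * ε} +
      ENNReal.ofReal (Real.log T / Real.log (1 + (2 * gap μ a i - 4 * ε) / σ i) +
        2 * σ i / ε + 11 / 2 - (⌈k⌉ : ℝ) - k) := by
  -- The factor `3 / 2` is chosen so that `2 * c - 2 * (μ i + ε / 2)` equals `y`.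
  set c := μ a - 3 / 2 * ε with hc
  set y := 2 * gap μ a i - 4 * ε with hy_def
  set n₀ := initialPlays k with hn₀
  have hs := hσ i
  have hy : 0 < y := by linarith
  have hT0 : (1 : ℝ) ≤ T := by exact_mod_cast hT
  have hys : 0 < y / σ i := by positivity
  set L := Real.log T / Real.log (1 + y / σ i) with hL
  have hL0 : 0 ≤ L := div_nonneg (Real.log_nonneg hT0) (Real.log_nonneg (by linarith))
  -- Taking `N ≥ n₀` lets the initial rounds be counted in `S₁`; the other term is the sample size
  -- required by `posterior_real_Ioi_le`.
  set N := max n₀ ⌈2 - k + L⌉₊ with hN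
  have hNle : (N : ℝ) ≤ n₀ + (2 - k + L) := by
    have h1 := Nat.ceil_lt_add_one (show 0 ≤ 2 - k + L by linarith)
    have h2 : (2 : ℝ) ≤ n₀ := by exact_mod_cast two_le_initialPlays k
    rw [hN, Nat.cast_max]
    exact max_le (by linarith) (by linarith)
  let S₁ : ℕ → Set Ω := fun n => {ω | n < N}
  let S₂ : ℕ → Set Ω := fun n => {ω | N ≤ n ∧ 2 * (μ i + ε / 2) < lo (X i · ω) n + hi (X i · ω) n}
  let E : ℕ → Set Ω := fun t => {ω | N ≤ pulls j i t ω ∧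
    lo (X i · ω) (pulls j i t ω) + hi (X i · ω) (pulls j i t ω) ≤ 2 * (μ i + ε / 2)}
  have hS₁ : ∀ n, MeasurableSet (S₁ n) := fun n => MeasurableSet.const _
  have hS₂ : ∀ n, MeasurableSet (S₂ n) := fun n =>
    (MeasurableSet.const _).inter (measurableSet_lt measurable_const
      ((measurable_lo (h.measurable_reward i) n).add (measurable_hi (h.measurable_reward i) n)))
  have hE : ∀ t, MeasurableSet[past X θ j t] (E t) := by
    intro t
    have hm := @measurable_pulls Ω K j i (past X θ j t) t fun s hs => measurable_arm_past hs
    have hX := fun n => measurable_reward_past (X := X) (θ := θ) (j := j) i n t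
    have hm' := @measurable_comp_pulls Ω K j i ℝ _ (past X θ j t) t
      (fun s hs => measurable_arm_past hs) (fun n ω => lo (X i · ω) n + hi (X i · ω) n)
      fun n => (measurable_lo hX n).add (measurable_hi hX n)
    exact MeasurableSet.inter (hm (measurableSet_Ici (a := N)))
      (hm' (measurableSet_Iic (a := 2 * (μ i + ε / 2))))
  have hsub : ∀ t, {ω | j t ω = i} ⊆
      {ω | j t ω = i ∧ K * n₀ ≤ t ∧ ∀ i', (θ t i' ω).1 ≤ c} ∪
      ({ω | j t ω = i ∧ ω ∈ S₁ (pulls j i t ω)} ∪ ({ω | j t ω = i ∧ ω ∈ S₂ (pulls j i t ω)} ∪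
      {ω | K * n₀ ≤ t ∧ ω ∈ E t ∩ {ω | c < (θ t i ω).1}})) := by
    intro t ω hω
    have hω : j t ω = i := hω
    rcases lt_or_ge t (K * n₀) with ht | ht
    · exact Or.inr (Or.inl ⟨hω, (h.pulls_lt_initialPlays ht hω).trans_le (le_max_left _ _)⟩)
    rcases lt_or_ge (pulls j i t ω) N with hp | hp
    · exact Or.inr (Or.inl ⟨hω, hp⟩)
    rcases lt_or_ge (2 * (μ i + ε / 2))
      (lo (X i · ω) (pulls j i t ω) + hi (X i · ω) (pulls j i t ω)) with hb | hb
    · exact Or.inr (Or.inr (Or.inl ⟨hω, hp, hb⟩))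
    rcases lt_or_ge c (θ t i ω).1 with hθ | hθ
    · exact Or.inr (Or.inr (Or.inr ⟨ht, ⟨hp, hb⟩, hθ⟩))
    · refine Or.inl ⟨hω, ht, fun i' => (h.play_max t ht ω i').trans ?_⟩
      rwa [hω]
  have hb₁ : ∑ t ∈ Finset.range T, P {ω | j t ω = i ∧ ω ∈ S₁ (pulls j i t ω)} ≤
      ENNReal.ofReal N := by
    refine (sum_measure_pulls_le i P h.measurable_arm hS₁ T).trans ?_
    have : ∀ n, P (S₁ n) = if n < N then 1 else 0 := by
      intro n
      by_cases hn : n < N <;> simp [S₁, hn]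
    simp only [this]
    rw [← Finset.sum_filter, Finset.sum_const, nsmul_one, ENNReal.ofReal_natCast]
    norm_cast
    calc _ ≤ (Finset.range N).card := Finset.card_le_card fun n hn => by
          simp only [Finset.mem_filter, Finset.mem_range] at hn ⊢
          exact hn.2
      _ = N := Finset.card_range N
  have hb₂ : ∑ t ∈ Finset.range T, P {ω | j t ω = i ∧ ω ∈ S₂ (pulls j i t ω)} ≤
      ENNReal.ofReal (σ i / ε) := by
    refine (sum_measure_pulls_le i P h.measurable_arm hS₂ T).trans ?_
    -- The geometric bound is summed from exponent one, so the term at zero has to vanish.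
    have hzero : S₂ 0 = ∅ := by
      ext ω
      have : 2 ≤ N := (two_le_initialPlays k).trans (le_max_left _ _)
      simp only [S₂, Set.mem_ofPred_eq, Set.mem_empty_iff_false, iff_false, not_and]
      omega
    calc _ ≤ ∑ n ∈ Finset.range (T + 1), P (S₂ n) :=
          Finset.sum_le_sum_of_subset (Finset.range_subset_range.2 T.le_succ)
      _ = ∑ n ∈ Finset.range T, P (S₂ (n + 1)) := by
          rw [Finset.sum_range_succ', hzero, measure_empty, add_zero]
      _ ≤ ∑ n ∈ Finset.range T, ENNReal.ofReal (max 0 (1 - ε / σ i) ^ (n + 1)) := by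
          refine Finset.sum_le_sum fun n _ => (measure_mono fun ω hω => hω.2).trans
            ((measure_midrange_gt_le hs (h.measurable_reward i) (h.reward_law i)
              (h.iIndepFun_reward i) (by omega) (ε / 2)).trans_eq ?_)
          rw [mul_div_cancel₀ _ two_ne_zero]
      _ ≤ _ := by
          rw [← ENNReal.ofReal_sum_of_nonneg fun n _ => by positivity]
          refine ENNReal.ofReal_le_ofReal ((sum_pow_max_le (by positivity) T).trans_eq ?_)
          field_simp
  have hb₃ : ∑ t ∈ Finset.range T, P {ω | K * n₀ ≤ t ∧ ω ∈ E t ∩ {ω | c < (θ t i ω).1}} ≤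
      ENNReal.ofReal (1 / 2) := by
    calc _ ≤ ∑ t ∈ Finset.range T, ENNReal.ofReal (1 / (2 * T)) := by
          refine Finset.sum_le_sum fun t _ => ?_
          by_cases ht : K * n₀ ≤ t
          · simp only [ht, true_and]
            refine h.measure_inter_lt_sample_le ht i (hE t) ?_
            filter_upwards [h.ae_lo_lt_hi hσ i,
              ae_mem_Icc (h.measurable_reward i) (h.reward_law i)] with ω hlt hmem hω
            have hn := h.initialPlays_le_pulls ht i ω
            have hn2 : 2 ≤ pulls j i t ω := (two_le_initialPlays k).trans hn
            have hNn : (N : ℝ) ≤ pulls j i t ω := by exact_mod_cast hω.1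
            have hceil : 2 - k + L ≤ pulls j i t ω :=
              (Nat.le_ceil _).trans (le_trans (by exact_mod_cast le_max_right _ _) hNn)
            have hnk : 0 < pulls j i t ω + k - 2 := by
              have := initialPlays_add_pos hk
              have : (initialPlays k : ℝ) ≤ pulls j i t ω := by exact_mod_cast hn
              linarith
            have hω2 := hω.2
            refine posterior_real_Ioi_le hs hy (by omega) hnk (by linarith) (hlt _ hn2) ?_ ?_ hceil
            · obtain ⟨p, hp, hep⟩ := exists_lo_eq (X i · ω) (show 1 ≤ pulls j i t ω by omega)
              obtain ⟨q, hq, heq⟩ := exists_hi_eq (X i · ω) (show 1 ≤ pulls j i t ω by omega)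
              rw [hep, heq]
              linarith [(hmem p).1, (hmem q).2]
            · rw [hy_def, hc]
              unfold gap
              linarith
          · simp [ht]
      _ = _ := by
          rw [Finset.sum_const, Finset.card_range, nsmul_eq_mul, ← ENNReal.ofReal_natCast,
            ← ENNReal.ofReal_mul (by positivity)]
          congr 1
          field_simp
  calc _ ≤ ∑ t ∈ Finset.range T, (P {ω | j t ω = i ∧ K * n₀ ≤ t ∧ ∀ i', (θ t i' ω).1 ≤ c} +
        (P {ω | j t ω = i ∧ ω ∈ S₁ (pulls j i t ω)} + (P {ω | j t ω = i ∧ ω ∈ S₂ (pulls j i t ω)} +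
        P {ω | K * n₀ ≤ t ∧ ω ∈ E t ∩ {ω | c < (θ t i ω).1}}))) := by
        refine Finset.sum_le_sum fun t _ => (measure_mono (hsub t)).trans ?_
        refine (measure_union_le _ _).trans ?_
        gcongr
        refine (measure_union_le _ _).trans ?_
        gcongr
        exact measure_union_le _ _
    _ ≤ ∑ t ∈ Finset.range T, P {ω | j t ω = i ∧ K * n₀ ≤ t ∧ ∀ i', (θ t i' ω).1 ≤ c} +
        (ENNReal.ofReal N + (ENNReal.ofReal (σ i / ε) + ENNReal.ofReal (1 / 2))) := by
        rw [Finset.sum_add_distrib, Finset.sum_add_distrib, Finset.sum_add_distrib]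
        gcongr
    _ ≤ _ := by
        gcongr
        rw [← ENNReal.ofReal_add (by positivity) (by positivity),
          ← ENNReal.ofReal_add (by positivity) (by positivity)]
        -- With `n₀ = 3 - ⌈k⌉`, the sum `n₀ + 2 + 1 / 2` is `11 / 2 - ⌈k⌉`; only one of the two
        -- terms `σ i / ε` is used.
        refine ENNReal.ofReal_le_ofReal ?_
        have h1 := initialPlays_eq hk
        have h2 : 0 ≤ σ i / ε := by positivity
        rw [← hn₀] at h1
        rw [mul_div_assoc]
        linarith

end IsThompsonSampling

/-! ### The finite-time regret bound -/

variable [IsProbabilityMeasure P]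

lemma gap_le_maxGap {K : ℕ} (μ : Fin K → ℝ) {a i : Fin K} (hi : i ≠ a) :
    gap μ a i ≤ maxGap μ a :=
  le_ciSup (f := fun i : {i : Fin K // i ≠ a} => gap μ a i) (Set.finite_range _).bddAbove ⟨i, hi⟩

lemma expRegret_eq (hj : ∀ t, Measurable (j t)) (a : Fin K) (T : ℕ) :
    expRegret P μ a j T =
      ∑ i ∈ Finset.univ.erase a, gap μ a i * ∑ t ∈ Finset.range T, P.real {ω | j t ω = i} := by
  have hmeas : ∀ t i, MeasurableSet {ω | j t ω = i} := fun t i =>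
    hj t (measurableSet_singleton i)
  have hpt : ∀ t ω, gap μ a (j t ω) =
      ∑ i ∈ Finset.univ.erase a, {ω | j t ω = i}.indicator (fun _ => gap μ a i) ω := by
    intro t ω
    rw [Finset.sum_erase _ (by simp [gap])]
    simp [Set.indicator]
  have hint : ∀ t i, Integrable ({ω | j t ω = i}.indicator fun _ => gap μ a i) P := fun t i =>
    (integrable_const _).indicator (hmeas t i)
  unfold expRegret regret
  simp_rw [hpt]
  rw [integral_finsetSum _ fun t _ => integrable_finsetSum _ fun i _ => hint t i]
  simp_rw [integral_finsetSum _ fun i _ => hint _ i, integral_indicator_const _ (hmeas _ _),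
    Finset.mul_sum, smul_eq_mul]
  rw [Finset.sum_comm]
  simp_rw [mul_comm]

lemma IsThompsonSampling.expRegret_le (h : IsThompsonSampling P μ σ k X θ j) (hK : 2 ≤ K)
    (hσ : ∀ i, 0 < σ i) {a : Fin K} (ha : ∀ i, i ≠ a → μ i < μ a) (hk : k < 1)
    {ε : ℝ} (hε : 0 < ε) (hgap : ∀ i, i ≠ a → ε < gap μ a i / 2) {T : ℕ} (hT : 1 ≤ T) :
    expRegret P μ a j T ≤
      ∑ i ∈ Finset.univ.erase a, gap μ a i *
        (Real.log T / Real.log (1 + (2 * gap μ a i - 4 * ε) / σ i) +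
          2 * σ i / ε + 11 / 2 - (⌈k⌉ : ℝ) - k) + maxGap μ a * constC ε k (σ a) := by
  set c := μ a - 3 / 2 * ε with hc
  set A : Fin K → ℝ := fun i => Real.log T / Real.log (1 + (2 * gap μ a i - 4 * ε) / σ i) +
          2 * σ i / ε + 11 / 2 - (⌈k⌉ : ℝ) - k with hA
  set D : ℕ → Set Ω := fun t => {ω | K * initialPlays k ≤ t ∧ ∀ i, (θ t i ω).1 ≤ c} with hD
  have hDm : ∀ t, MeasurableSet (D t) := fun t => (MeasurableSet.const _).inter
    (h.measurableSet_samples t (B := fun _ => Prod.fst ⁻¹' Set.Iic c)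
      fun _ => measurable_fst measurableSet_Iic)
  have hjm : ∀ t i, MeasurableSet {ω | j t ω = i} := fun t i =>
    h.measurable_arm t (measurableSet_singleton i)
  have hT0 : (1 : ℝ) ≤ T := by exact_mod_cast hT
  have hA0 : ∀ i, i ≠ a → 0 ≤ A i := by
    intro i hi
    have h1 : 0 ≤ Real.log T / Real.log (1 + (2 * gap μ a i - 4 * ε) / σ i) := by
      refine div_nonneg (Real.log_nonneg hT0) (Real.log_nonneg ?_)
      have : 0 ≤ (2 * gap μ a i - 4 * ε) / σ i :=
        div_nonneg (by linarith [hgap i hi]) (hσ i).le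
      linarith
    have h2 : 0 ≤ 2 * σ i / ε := by have := hσ i; positivity
    have h3 : (⌈k⌉ : ℝ) ≤ 1 := by exact_mod_cast Int.ceil_le.2 (by simpa using hk.le)
    simp only [hA]
    linarith
  have harm : ∀ i, i ≠ a → ∑ t ∈ Finset.range T, P.real {ω | j t ω = i} ≤
      ∑ t ∈ Finset.range T, P.real ({ω | j t ω = i} ∩ D t) + A i := by
    intro i hi
    have h1 := h.sum_measure_arm_le hσ hk hε (hgap i hi) hT
    have h2 := ENNReal.toReal_mono (ENNReal.add_ne_top.2
      ⟨ENNReal.sum_ne_top.2 fun t _ => measure_ne_top _ _, ENNReal.ofReal_ne_top⟩) h1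
    rwa [ENNReal.toReal_add (ENNReal.sum_ne_top.2 fun t _ => measure_ne_top _ _)
      ENNReal.ofReal_ne_top, ENNReal.toReal_sum fun t _ => measure_ne_top _ _,
      ENNReal.toReal_sum fun t _ => measure_ne_top _ _, ENNReal.toReal_ofReal (hA0 i hi)] at h2
  have hDsum : ∑ t ∈ Finset.range T, P.real (D t) ≤ constC ε k (σ a) := by
    have hd : 0 < 3 / 2 * ε / σ a := by have := hσ a; positivity
    have h1 := h.sum_measure_forall_sample_le hσ hk a hd T
    rw [div_mul_cancel₀ _ (hσ a).ne'] at h1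
    have h2 := ENNReal.toReal_mono ENNReal.ofReal_ne_top h1
    have hk' : 0 < 1 - k := by linarith
    rw [ENNReal.toReal_sum fun t _ => measure_ne_top _ _,
      ENNReal.toReal_ofReal (by positivity)] at h2
    exact h2.trans (constC_bound hε (hσ a) hk)
  -- A round plays one arm, so the low-sample rounds are paid for once in total, at the price
  -- `maxGap`, and not once per arm.
  have hdisj : ∀ t, ∑ i ∈ Finset.univ.erase a, P.real ({ω | j t ω = i} ∩ D t) ≤ P.real (D t) := by
    intro t
    rw [← measureReal_biUnion_finset]
    · exact measureReal_mono (Set.iUnion₂_subset fun i _ => Set.inter_subset_right)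
    · intro i _ i' _ hne
      refine Set.disjoint_left.2 fun ω hω hω' => hne ?_
      exact hω.1.symm.trans hω'.1
    · exact fun i _ => (hjm t i).inter (hDm t)
  have hmax : 0 ≤ maxGap μ a := by
    have : Nontrivial (Fin K) := Fin.nontrivial_iff_two_le.2 hK
    obtain ⟨i, hi⟩ := exists_ne a
    exact (sub_pos.2 (ha i hi)).le.trans (gap_le_maxGap μ hi)
  rw [expRegret_eq h.measurable_arm]
  calc _ ≤ ∑ i ∈ Finset.univ.erase a, (gap μ a i * A i +
        maxGap μ a * ∑ t ∈ Finset.range T, P.real ({ω | j t ω = i} ∩ D t)) := by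
        refine Finset.sum_le_sum fun i hi => ?_
        have hi' := Finset.ne_of_mem_erase hi
        have hg : 0 ≤ gap μ a i := (sub_pos.2 (ha i hi')).le
        have hs : 0 ≤ ∑ t ∈ Finset.range T, P.real ({ω | j t ω = i} ∩ D t) :=
          Finset.sum_nonneg fun _ _ => measureReal_nonneg
        have h1 := mul_le_mul_of_nonneg_left (harm i hi') hg
        have h2 := mul_le_mul_of_nonneg_right (gap_le_maxGap μ hi') hs
        linarith
    _ = ∑ i ∈ Finset.univ.erase a, gap μ a i * A i + maxGap μ a *
        ∑ t ∈ Finset.range T, ∑ i ∈ Finset.univ.erase a, P.real ({ω | j t ω = i} ∩ D t) := by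
        rw [Finset.sum_add_distrib, ← Finset.mul_sum, Finset.sum_comm (s := Finset.univ.erase a)]
    _ ≤ _ := by
        gcongr
        exact (Finset.sum_le_sum fun t _ => hdisj t).trans hDsum

end sampling

/-! ### Asymptotic optimality -/

/-- The terms `b` and `c` may blow up as `ε → 0`, but they do not depend on `T`: the limit in `T`
removes them for fixed `ε`, and `ε → 0` is taken afterwards by continuity. -/
lemma limsup_div_log_le {K : ℕ} {μ σ : Fin K → ℝ} (hσ : ∀ i, 0 < σ i) {a : Fin K}
    (ha : ∀ i, i ≠ a → μ i < μ a) {r : ℕ → ℝ} {b c : ℝ → Fin K → ℝ}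
    (hr : ∀ ε : ℝ, 0 < ε → (∀ i, i ≠ a → ε < gap μ a i / 2) → ∀ T : ℕ, 1 ≤ T →
      r T ≤ ∑ i ∈ Finset.univ.erase a, gap μ a i *
        (Real.log T / Real.log (1 + (2 * gap μ a i - 4 * ε) / σ i) + b ε i) + c ε a) :
    limsup (fun T : ℕ => ((r T / Real.log T : ℝ) : EReal)) atTop ≤
      ((∑ i ∈ Finset.univ.erase a, gap μ a i / Real.log (1 + 2 * gap μ a i / σ i) : ℝ) : EReal) := by
  let g : ℝ → ℝ := fun ε => ∑ i ∈ Finset.univ.erase a,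
    gap μ a i / Real.log (1 + (2 * gap μ a i - 4 * ε) / σ i)
  have hg : Tendsto g (nhdsWithin 0 (Set.Ioi 0)) (nhds (g 0)) := by
    refine tendsto_finsetSum _ fun i hi => ?_
    have hpos : 0 < gap μ a i := sub_pos.2 (ha i (Finset.ne_of_mem_erase hi))
    have hfrac : 0 < (2 * gap μ a i - 4 * 0) / σ i := div_pos (by linarith) (hσ i)
    have hcont : ContinuousAt
        (fun ε : ℝ => gap μ a i / Real.log (1 + (2 * gap μ a i - 4 * ε) / σ i)) 0 := by
      refine ContinuousAt.div continuousAt_const (ContinuousAt.log (by fun_prop) ?_) ?_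
      · exact (by linarith : 0 < 1 + (2 * gap μ a i - 4 * 0) / σ i).ne'
      · exact (Real.log_pos (by linarith)).ne'
    exact hcont.tendsto.mono_left nhdsWithin_le_nhds
  have hsmall : ∀ᶠ ε in nhdsWithin (0 : ℝ) (Set.Ioi 0), ∀ i, i ≠ a → ε < gap μ a i / 2 := by
    refine eventually_all.2 fun i => ?_
    by_cases hi : i = a
    · simp [hi]
    · have hpos : 0 < gap μ a i / 2 := half_pos (sub_pos.2 (ha i hi))
      filter_upwards [nhdsWithin_le_nhds (Iio_mem_nhds hpos)] with ε hε _ using hε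
  have hbound : ∀ ε : ℝ, 0 < ε → (∀ i, i ≠ a → ε < gap μ a i / 2) →
      limsup (fun T : ℕ => ((r T / Real.log T : ℝ) : EReal)) atTop ≤ (g ε : EReal) := by
    intro ε hε hε'
    let C := ∑ i ∈ Finset.univ.erase a, gap μ a i * b ε i + c ε a
    have hlog : Tendsto (fun T : ℕ => Real.log T) atTop atTop :=
      Real.tendsto_log_atTop.comp tendsto_natCast_atTop_atTop
    have hlim : Tendsto (fun T : ℕ => g ε + C / Real.log T) atTop (nhds (g ε)) := by
      simpa using tendsto_const_nhds.add (hlog.const_div_atTop C)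
    have hlim' : Tendsto (fun T : ℕ => ((g ε + C / Real.log T : ℝ) : EReal)) atTop
        (nhds (g ε : EReal)) := (continuous_coe_real_ereal.tendsto _).comp hlim
    rw [← hlim'.limsup_eq]
    refine limsup_le_limsup ?_
    filter_upwards [eventually_ge_atTop 2] with T hT
    have hT' : (1 : ℝ) < T := by exact_mod_cast hT
    have hlogT : 0 < Real.log T := Real.log_pos hT'
    refine EReal.coe_le_coe_iff.2 ?_
    rw [div_le_iff₀ hlogT]
    refine (hr ε hε hε' T (by omega)).trans (le_of_eq ?_)
    simp only [g, C]
    rw [add_mul, div_mul_cancel₀ _ hlogT.ne', Finset.sum_mul, ← add_assoc,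
      ← Finset.sum_add_distrib]
    congr 1
    exact Finset.sum_congr rfl fun i _ => by ring
  have hg0 : g 0 = ∑ i ∈ Finset.univ.erase a,
      gap μ a i / Real.log (1 + 2 * gap μ a i / σ i) := by simp [g]
  rw [← hg0]
  refine ge_of_tendsto ((continuous_coe_real_ereal.tendsto _).comp hg) ?_
  filter_upwards [hsmall, self_mem_nhdsWithin] with ε hε hε0 using hbound ε hε0 hε

end UniformBandit

end

theorem theorem1 {K : ℕ} (hK : 2 ≤ K) (μ σ : Fin K → ℝ) (hσ : ∀ i, 0 < σ i)
    (a : Fin K) (ha : ∀ i, i ≠ a → μ i < μ a) (k : ℝ) (hk : k < 1)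
    {Ω : Type*} [MeasurableSpace Ω] (P : Measure Ω) [IsProbabilityMeasure P]
    (X : Fin K → ℕ → Ω → ℝ) (θ : ℕ → Fin K → Ω → ℝ × ℝ) (j : ℕ → Ω → Fin K)
    (hTS : UniformBandit.IsThompsonSampling P μ σ k X θ j) :
    -- the finite-time bound
    (∀ ε : ℝ, 0 < ε → (∀ i, i ≠ a → ε < UniformBandit.gap μ a i / 2) → ∀ T : ℕ, 1 ≤ T →
      UniformBandit.expRegret P μ a j T ≤
        ∑ i ∈ Finset.univ.erase a, UniformBandit.gap μ a i *
          (Real.log T / Real.log (1 + (2 * UniformBandit.gap μ a i - 4 * ε) / σ i) +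
            2 * σ i / ε + 11 / 2 - (⌈k⌉ : ℝ) - k) +
        UniformBandit.maxGap μ a * UniformBandit.constC ε k (σ a)) ∧
    -- the order of the constant, uniformly for `k` bounded below and `ε / s` bounded
    (∀ k₀ R : ℝ, ∃ M : ℝ, ∀ k' : ℝ, k₀ ≤ k' → k' < 1 → ∀ s : ℝ, 0 < s → ∀ ε : ℝ, 0 < ε →
      ε ≤ R * s → |UniformBandit.constC ε k' s| ≤ M * (s ^ 2 / ((1 - k') * ε ^ 2))) ∧
    -- asymptotic optimality, and the explicit value of the optimal constant
    limsup (fun T : ℕ => ((UniformBandit.expRegret P μ a j T / Real.log T : ℝ) : EReal)) atTop ≤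
      ((∑ i ∈ Finset.univ.erase a,
        UniformBandit.gap μ a i / (UniformBandit.klInf μ σ a i).toReal : ℝ) : EReal) ∧
    (∀ i, i ≠ a → UniformBandit.klInf μ σ a i =
      ENNReal.ofReal (Real.log (1 + 2 * UniformBandit.gap μ a i / σ i))) := by
  have hfin := fun (ε : ℝ) (hε : 0 < ε) (hgap : ∀ i, i ≠ a → ε < UniformBandit.gap μ a i / 2)
    (T : ℕ) (hT : 1 ≤ T) => hTS.expRegret_le hK hσ ha hk hε hgap hT
  refine ⟨hfin, UniformBandit.constC_isBigO, ?_, fun i hi => UniformBandit.klInf_eq hσ (ha i hi)⟩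
  have hkl : ∀ i ∈ Finset.univ.erase a, UniformBandit.gap μ a i /
      (UniformBandit.klInf μ σ a i).toReal = UniformBandit.gap μ a i /
        Real.log (1 + 2 * UniformBandit.gap μ a i / σ i) := by
    intro i hi
    have hlt := ha i (Finset.ne_of_mem_erase hi)
    have hpos : 0 ≤ 2 * UniformBandit.gap μ a i / σ i :=
      div_nonneg (mul_nonneg zero_le_two (sub_pos.2 hlt).le) (hσ i).le
    rw [UniformBandit.klInf_eq hσ hlt, ENNReal.toReal_ofReal (Real.log_nonneg (by linarith))]
  rw [Finset.sum_congr rfl hkl]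
  refine UniformBandit.limsup_div_log_le hσ ha
    (b := fun ε i => 2 * σ i / ε + 11 / 2 - (⌈k⌉ : ℝ) - k)
    (c := fun ε i => UniformBandit.maxGap μ i * UniformBandit.constC ε k (σ i)) ?_
  intro ε hε hgap T hT
  refine (hfin ε hε hgap T hT).trans (le_of_eq ?_)
  congr 1
  exact Finset.sum_congr rfl fun i _ => by ring
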